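/- Let $m,n\ge 1$, $q=\min\{m,n\}$, and let $F$ be a complex $m\times n$ matrix of rank $r$ with singular values $s_1(F)\ge\dots\ge s_q(F)\ge 0$. Let $\Phi$ be a symmetric gauge function on $\mathbb{R}^q$, i.e. a norm with $\Phi(x_1,\dots,x_q)=\Phi(|x_{\sigma(1)}|,\dots,|x_{\sigma(q)}|)$ for every permutation $\sigma$, and put $\|A\|_\Phi=\Phi(s_1(A),\dots,s_q(A))$ for $A\in\mathbb{C}^{m\times n}$. A matrix $X\in\mathbb{C}^{m\times n}$ is a partial isometry if $\|Xf\|=\|f\|$ for all $f\in\ker(X)^\perp$. Let $\mathcal{I}^k$ be the set of $m\times n$ partial isometries of rank $k$, and let $\mathcal{I}=\bigcup_{k=1}^q\mathcal{I}^k$ be the set of nonzero partial isometries. For $\mathcal S\subseteq\mathcal I$, the closest elements of $\mathcal S$ to $F$ are the minimizers of $\|F-X\|_\Phi$ over $X\in\mathcal{S}$; a global minimizer is a closest element of $\mathcal{I}$ to $F$. In all the cases below, the closest elements named exist. a) Suppose that $s_i(F)\ne 1/2$ for all $i=1,\dots,r$. i) If $r\ge1$, $s_r(F)>1/2$ and $F=U|F|$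 is the canonical polar decomposition (that is, $|F|=(F^*F)^{1/2}$ and $U$ is the unique partial isometry with $F=U|F|$ and $\ker U=\ker F$), then $U$ is a global minimizer. More generally, if $s_k(F)>1/2>s_{k+1}(F)$ for some $1\le k\le r-1$, then every closest element of $\mathcal{I}^k$ to $F$ is a global minimizer (and there is only one such element if $\Phi$ is strictly convex). ii) If $s_1(F)<1/2$, then the closest elements of $\mathcal{I}^1$ to $F$ are global minimizers. b) Suppose that $\{j: s_j(F)=1/2\}=\{k,\dots,k+l\}$, where $1\le k\le r$ and $0\le l\le r-k$. i) If $k=1$, then the closest elements of each of $\mathcal{I}^1,\dots,\mathcal{I}^{l+1}$ to $F$ are global minimizers. ii) If $1<k\le r$, then the closest elements of each of $\mathcal{I}^{k-1},\dots,\mathcal{I}^{k+l}$ to $F$ are global minimizers. Moreover, in all the cases these are the only global minimizers if $\Phi$ is strictly convex, i.e. if $\Phi(\lambda x+(1-\lambda)y)<1$ whenever $x\ne y$, $\Phi(x)=\Phi(y)=1$ and $0<\lambda<1$. -/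

import Mathlib

noncomputable section

/-- The linear map `ℂⁿ → ℂᵐ` (Euclidean norms) given by an `m × n` complex matrix. -/
abbrev matMap {m n : ℕ} (X : Matrix (Fin m) (Fin n) ℂ) :
    EuclideanSpace ℂ (Fin n) →ₗ[ℂ] EuclideanSpace ℂ (Fin m) :=
  Matrix.toEuclideanLin X

/-- `singVal F j` is the `j`-th largest singular value `s_j(F)`, for `j = 1, 2, …`
(Mathlib counts singular values from `0`). It is `0` for `j > min m n`. -/
def singVal {m n : ℕ} (F : Matrix (Fin m) (Fin n) ℂ) (j : ℕ) : ℝ :=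
  (matMap F).singularValues (j - 1)

/-- `X` is a partial isometry: `‖X f‖ = ‖f‖` for all `f ∈ ker(X)^⊥`. -/
def IsPartialIsometry {m n : ℕ} (X : Matrix (Fin m) (Fin n) ℂ) : Prop :=
  ∀ f ∈ (LinearMap.ker (matMap X))ᗮ, ‖matMap X f‖ = ‖f‖

/-- The nonzero `m × n` partial isometries, i.e. those of rank `1, …, min m n`. -/
def partialIsometries (m n : ℕ) : Set (Matrix (Fin m) (Fin n) ℂ) :=
  {X | IsPartialIsometry X ∧ X ≠ 0}

/-- The `m × n` partial isometries of rank `k`. -/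
def partialIsometriesOfRank (m n k : ℕ) : Set (Matrix (Fin m) (Fin n) ℂ) :=
  {X | IsPartialIsometry X ∧ X.rank = k}

open scoped MatrixOrder in
/-- `|F| = (F* F)^{1/2}`. -/
def matAbs {m n : ℕ} (F : Matrix (Fin m) (Fin n) ℂ) : Matrix (Fin n) (Fin n) ℂ :=
  CFC.sqrt (F.conjTranspose * F)

/-- `F = U |F|` is the canonical polar decomposition: `U` is a partial isometry with the same
kernel as `F`. -/
def IsCanonicalPolar {m n : ℕ} (F U : Matrix (Fin m) (Fin n) ℂ) : Prop :=
  IsPartialIsometry U ∧ LinearMap.ker (matMap U) = LinearMap.ker (matMap F) ∧ F = U * matAbs F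

/-- A symmetric gauge function on `ℝ^q`: a norm (a definite seminorm) which is invariant under
permutations and sign changes of the coordinates. -/
structure IsSymmetricGauge {q : ℕ} (Φ : Seminorm ℝ (Fin q → ℝ)) : Prop where
  definite : ∀ x, Φ x = 0 → x = 0
  symm : ∀ (σ : Equiv.Perm (Fin q)) (x : Fin q → ℝ), Φ x = Φ (fun i => |x (σ i)|)

/-- Strict convexity of a norm on `ℝ^q`. -/
def IsStrictlyConvexGauge {q : ℕ} (Φ : Seminorm ℝ (Fin q → ℝ)) : Prop :=
  ∀ x y : Fin q → ℝ, x ≠ y → Φ x = 1 → Φ y = 1 →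
    ∀ t : ℝ, 0 < t → t < 1 → Φ (t • x + (1 - t) • y) < 1

/-- `‖F‖_Φ = Φ(s_1(F), …, s_q(F))`, where `q = min m n`. -/
def gaugeNorm {m n : ℕ} (Φ : Seminorm ℝ (Fin (min m n) → ℝ)) (F : Matrix (Fin m) (Fin n) ℂ) : ℝ :=
  Φ (fun i => singVal F (i.val + 1))

/-- The elements of `S` closest to `F`, i.e. the minimizers of `‖F - X‖_Φ` over `X ∈ S`. -/
def closestIn {m n : ℕ} (Φ : Seminorm ℝ (Fin (min m n) → ℝ)) (F : Matrix (Fin m) (Fin n) ℂ)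
    (S : Set (Matrix (Fin m) (Fin n) ℂ)) : Set (Matrix (Fin m) (Fin n) ℂ) :=
  {X | X ∈ S ∧ ∀ Y ∈ S, gaugeNorm Φ (F - X) ≤ gaugeNorm Φ (F - Y)}

end

/-! A partial isometry of rank k has singular values 1 (k times) and then 0. Mirsky's inequality
Φ(|s(F) - s(X)|) ≤ ‖F - X‖_Φ therefore keeps it at distance at least Φ(`gapVec F k`) from F, and the
singular value decomposition of F with the first k singular values replaced by 1 and the others by 0
attains this bound. What remains is to compare the vectors `gapVec F k`. Their entries are |s_i - 1|
for i ≤ k and s_i for i > k; the first is the smaller when s_i > 1/2, the second when s_i < 1/2, and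
they tie at 1/2. A rank that rounds every s_i correctly minimizes all coordinates at once, and Φ is
monotone. Since the rank is at least 1, the first coordinate is |s_1 - 1| in every case.

Mirsky's inequality rests on two facts. Fan dominance (`IsSymmetricGauge.le_of_truncated_sums`)
reduces it to the sums ∑ max (d_i - t) 0 for t ≥ 0. Those sums are bounded by Weyl monotonicity
(`sum_truncated_le_trace`), applied to Hermitian dilations, whose nonzero eigenvalues are the
numbers ±s_i ≠ 0.

In the strictly convex case, equality in Fan dominance makes one vector a signed permutation of the
other. Only the equality of the sums of squares is kept: it puts equality in Mirsky's inequality on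
the level of the Frobenius norm, where the trace inequality determines X if there is a gap after s_k
(`apply_eq_of_sum_sq_singularValues_sub`). It also makes the monotonicity of Φ strict, which
excludes all other ranks. -/

/-! ### Symmetric gauge functions and Fan dominance -/

noncomputable section

/-- Abel summation: an antitone nonnegative weight preserves domination of partial sums. -/
theorem sum_range_mul_nonneg_of_antitone {w δ : ℕ → ℝ} (hw : Antitone w) (hw0 : ∀ i, 0 ≤ w i)
    {N : ℕ} (hδ : ∀ k ≤ N, 0 ≤ ∑ i ∈ Finset.range k, δ i) :
    0 ≤ ∑ i ∈ Finset.range N, w i * δ i := by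
  -- The induction carries the last weight times the partial sum; lowering `w k` to `w (k + 1)` only
  -- helps, because the partial sum is nonnegative.
  suffices h : ∀ k ≤ N, w k * ∑ i ∈ Finset.range k, δ i ≤ ∑ i ∈ Finset.range k, w i * δ i from
    (mul_nonneg (hw0 N) (hδ N le_rfl)).trans (h N le_rfl)
  intro k
  induction k with
  | zero => simp
  | succ k ih =>
    intro hk
    have h1 := ih (by omega)
    have h2 := mul_le_mul_of_nonneg_right (hw (Nat.le_succ k)) (hδ (k + 1) hk)
    rw [Finset.sum_range_succ] at h2 ⊢
    rw [Finset.sum_range_succ]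
    nlinarith

/-- A real family on `Fin q` can be sorted in decreasing order. -/
theorem exists_perm_antitone {q : ℕ} (c : Fin q → ℝ) :
    ∃ σ : Equiv.Perm (Fin q), Antitone (c ∘ σ) := by
  refine ⟨Tuple.sort (fun i => -c i), fun i j hij => ?_⟩
  have := Tuple.monotone_sort (fun i => -c i) hij
  simpa using this

/-- Abel summation transferred to `Fin q`; extending `w` by 0 keeps it antitone because it is
nonnegative. -/
theorem sum_mul_le_sum_mul_of_partial_sums {q : ℕ} {w x y : Fin q → ℝ} (hw : Antitone w)
    (hw0 : ∀ i, 0 ≤ w i)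
    (h : ∀ k ≤ q, ∑ i with i.val < k, x i ≤ ∑ i with i.val < k, y i) :
    ∑ i, w i * x i ≤ ∑ i, w i * y i := by
  let ext (f : Fin q → ℝ) (i : ℕ) : ℝ := if h : i < q then f ⟨i, h⟩ else 0
  have hsum : ∀ f : Fin q → ℝ, ∀ k ≤ q,
      ∑ i with i.val < k, f i = ∑ i ∈ Finset.range k, ext f i := by
    intro f k hk
    rw [Finset.sum_filter]
    have : ∀ i : Fin q, (if i.val < k then f i else 0) =
        (fun j : ℕ => if j < k then ext f j else 0) i := by
      intro i; simp [ext]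
    rw [Finset.sum_congr rfl fun i _ => this i,
      Fin.sum_univ_eq_sum_range (fun j : ℕ => if j < k then ext f j else 0), ← Finset.sum_filter]
    congr 1
    ext j
    simp only [Finset.mem_filter, Finset.mem_range]
    omega
  have hA : Antitone (ext w) := by
    intro i j hij
    simp only [ext]
    split_ifs with h1 h2 h2
    · exact hw hij
    · omega
    · exact hw0 _
    · exact le_rfl
  have hP : ∀ i, 0 ≤ ext w i := by
    intro i
    simp only [ext]
    split_ifs
    · exact hw0 _
    · exact le_rfl
  have key := sum_range_mul_nonneg_of_antitone (δ := fun i => ext y i - ext x i) (N := q) hA hP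
    (fun k hk => by
      rw [Finset.sum_sub_distrib, ← hsum y k hk, ← hsum x k hk]
      exact sub_nonneg.2 (h k hk))
  have h3 : ∀ f : Fin q → ℝ, ∑ i, w i * f i = ∑ i ∈ Finset.range q, ext w i * ext f i := by
    intro f
    rw [← Fin.sum_univ_eq_sum_range (fun i => ext w i * ext f i)]
    simp [ext]
  simp only [mul_sub, Finset.sum_sub_distrib] at key
  rw [h3, h3]
  linarith

/-- Domination of all truncated sums gives domination of sums of the largest entries. -/
theorem partial_sums_le_of_truncated_sums {q : ℕ} {d c : Fin q → ℝ} (hc : ∀ i, 0 ≤ c i)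
    (hca : Antitone c)
    (h : ∀ t : ℝ, 0 ≤ t → ∑ i, max (d i - t) 0 ≤ ∑ i, max (c i - t) 0) (σ : Equiv.Perm (Fin q)) :
    ∀ k ≤ q, ∑ i with i.val < k, d (σ i) ≤ ∑ i with i.val < k, c i := by
  intro k hk
  rcases Nat.eq_zero_or_pos k with rfl | hk0
  · simp
  -- At the level of the k-th largest entry of `c`, truncation keeps exactly the first k terms, so t
  -- cancels from both sides at the end.
  set t := c ⟨k - 1, by omega⟩ with ht
  have h1 := h t (hc _)
  have h2 : ∑ i with i.val < k, (d (σ i) - t) ≤ ∑ i, max (d i - t) 0 := by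
    rw [← Equiv.sum_comp σ (fun i => max (d i - t) 0)]
    calc ∑ i with i.val < k, (d (σ i) - t) ≤ ∑ i with i.val < k, max (d (σ i) - t) 0 :=
          Finset.sum_le_sum fun i _ => le_max_left _ _
      _ ≤ _ := Finset.sum_le_sum_of_subset_of_nonneg (Finset.filter_subset _ _)
          fun i _ _ => le_max_right _ _
  have h3 : ∑ i, max (c i - t) 0 = ∑ i with i.val < k, (c i - t) := by
    rw [Finset.sum_filter]
    refine Finset.sum_congr rfl fun i _ => ?_
    split_ifs with hi
    · exact max_eq_left (sub_nonneg.2 (hca (Fin.le_def.2 (by simp; omega))))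
    · exact max_eq_right (sub_nonpos.2 (hca (Fin.le_def.2 (by simp; omega))))
  rw [h3] at h1
  have h4 := h2.trans h1
  rw [Finset.sum_sub_distrib, Finset.sum_sub_distrib] at h4
  linarith

/-- If the truncated sums of `d` are dominated by those of `c`, every linear functional is at least
as large at a signed permutation of `c` as at `d`. -/
theorem exists_signed_perm_of_truncated_sums {q : ℕ} {d c : Fin q → ℝ} (hd : ∀ i, 0 ≤ d i)
    (hc : ∀ i, 0 ≤ c i)
    (h : ∀ t : ℝ, 0 ≤ t → ∑ i, max (d i - t) 0 ≤ ∑ i, max (c i - t) 0) (z : Fin q → ℝ) :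
    ∃ (ρ : Equiv.Perm (Fin q)) (c' : Fin q → ℝ), (∀ i, |c' (ρ i)| = c i) ∧
      ∑ i, z i * d i ≤ ∑ i, z i * c' i := by
  obtain ⟨τ, hτ⟩ := exists_perm_antitone c
  obtain ⟨σ, hσ⟩ := exists_perm_antitone (fun i => |z i|)
  let sg : Fin q → ℝ := fun i => if 0 ≤ z i then 1 else -1
  have hsg : ∀ i, |sg i| = 1 := by intro i; simp only [sg]; split_ifs <;> simp
  have hsz : ∀ i, z i * sg i = |z i| := by
    intro i; simp only [sg]
    split_ifs with h
    · rw [abs_of_nonneg h, mul_one]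
    · rw [abs_of_neg (not_le.1 h)]; ring
  -- The entries of `c` are placed so that the largest meets the largest |z i|, with the signs of
  -- `z`: the arrangement that maximizes the pairing.
  refine ⟨τ.symm.trans σ, fun i => sg i * c (τ (σ.symm i)), fun i => ?_, ?_⟩
  · simp [abs_mul, hsg, abs_of_nonneg (hc i)]
  · calc ∑ i, z i * d i ≤ ∑ i, |z i| * d i :=
          Finset.sum_le_sum fun i _ => mul_le_mul_of_nonneg_right (le_abs_self _) (hd i)
      _ = ∑ i, |z (σ i)| * d (σ i) := (Equiv.sum_comp σ (fun i => |z i| * d i)).symm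
      _ ≤ ∑ i, |z (σ i)| * c (τ i) := by
          refine sum_mul_le_sum_mul_of_partial_sums hσ (fun i => abs_nonneg _) ?_
          refine partial_sums_le_of_truncated_sums (fun i => hc _) hτ (fun t ht => ?_) σ
          refine (h t ht).trans_eq ?_
          exact (Equiv.sum_comp τ (fun i => max (c i - t) 0)).symm
      _ = ∑ i, |z i| * c (τ (σ.symm i)) := by
          rw [← Equiv.sum_comp σ (fun i => |z i| * c (τ (σ.symm i)))]
          simp
      _ = _ := by
          refine Finset.sum_congr rfl fun i _ => ?_
          rw [← hsz]; ring

/-- A seminorm has a support functional at every point. -/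
theorem Seminorm.exists_support_functional {E : Type*} [AddCommGroup E] [Module ℝ E]
    (Φ : Seminorm ℝ E) (d : E) : ∃ g : E →ₗ[ℝ] ℝ, g d = Φ d ∧ ∀ x, g x ≤ Φ x := by
  by_cases hd : d = 0
  · exact ⟨0, by simp [hd], fun x => by simp⟩
  let f : E →ₗ.[ℝ] ℝ := LinearPMap.mkSpanSingleton d (Φ d) hd
  obtain ⟨g, hg, hle⟩ := exists_extension_of_le_sublinear f Φ
    (fun c hc x => by rw [map_smul_eq_mul, Real.norm_of_nonneg hc.le])
    (fun x y => map_add_le_add Φ x y) (by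
      rintro ⟨x, hx⟩
      obtain ⟨a, rfl⟩ := Submodule.mem_span_singleton.1 hx
      have hf : f ⟨a • d, hx⟩ = a * Φ d := by
        simp only [f]
        rw [LinearPMap.mkSpanSingleton'_apply]
        simp
      rw [hf]
      change a * Φ d ≤ Φ (a • d)
      rw [map_smul_eq_mul, Real.norm_eq_abs]
      exact mul_le_mul_of_nonneg_right (le_abs_self a) (apply_nonneg Φ d))
  refine ⟨g, ?_, hle⟩
  rw [hg ⟨d, Submodule.mem_span_singleton_self d⟩]
  exact LinearPMap.mkSpanSingleton_apply ℝ ℝ hd (Φ d)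

/-- Fan dominance for symmetric gauge functions, with the case of equality. -/
theorem IsSymmetricGauge.le_of_truncated_sums {q : ℕ} {Φ : Seminorm ℝ (Fin q → ℝ)}
    (hΦ : IsSymmetricGauge Φ) {d c : Fin q → ℝ} (hd : ∀ i, 0 ≤ d i) (hc : ∀ i, 0 ≤ c i)
    (h : ∀ t : ℝ, 0 ≤ t → ∑ i, max (d i - t) 0 ≤ ∑ i, max (c i - t) 0) :
    Φ d ≤ Φ c ∧ (IsStrictlyConvexGauge Φ → Φ d = Φ c → ∑ i, d i ^ 2 = ∑ i, c i ^ 2) := by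
  obtain ⟨g, hgd, hg⟩ := Φ.exists_support_functional d
  have hrep : ∀ x, g x = ∑ i, g (Pi.single i 1) * x i := by
    intro x
    conv_lhs => rw [LinearMap.pi_apply_eq_sum_univ g x]
    refine Finset.sum_congr rfl fun i _ => ?_
    rw [smul_eq_mul, mul_comm]
    congr 2
    ext j
    simp [Pi.single_apply, eq_comm]
  obtain ⟨ρ, c', hc', hle⟩ := exists_signed_perm_of_truncated_sums hd hc h
    (fun i => g (Pi.single i 1))
  rw [← hrep, ← hrep] at hle
  have hΦc : Φ c' = Φ c := by
    rw [hΦ.symm ρ c']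
    congr 1
    ext i
    exact hc' i
  have hsq : ∑ i, c' i ^ 2 = ∑ i, c i ^ 2 := by
    rw [← Equiv.sum_comp ρ]
    exact Finset.sum_congr rfl fun i _ => by rw [← hc', sq_abs]
  refine ⟨by rw [← hgd, ← hΦc]; exact hle.trans (hg c'), fun hs heq => ?_⟩
  rw [← hsq]
  -- The support functional `g` at `d` is at least Φ d at `c'` as well. If `d ≠ c'`, their
  -- normalized midpoint would have Φ < 1 although `g` is at least 1 there.
  suffices hdc : d = c' by rw [hdc]
  by_contra hne
  set a := Φ d with ha
  have ha' : Φ c' = a := by rw [hΦc, heq]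
  have ha0 : 0 < a := by
    refine lt_of_le_of_ne (apply_nonneg Φ d) fun h0 => hne ?_
    rw [hΦ.definite d h0.symm, hΦ.definite c' (by rw [ha', ← h0])]
  have hn : ∀ x, Φ x = a → Φ (a⁻¹ • x) = 1 := by
    intro x hx
    rw [map_smul_eq_mul, hx, Real.norm_of_nonneg (by positivity), inv_mul_cancel₀ ha0.ne']
  have h1 := hs (a⁻¹ • d) (a⁻¹ • c')
    (fun he => hne (smul_right_injective _ (inv_ne_zero ha0.ne') he)) (hn d rfl) (hn c' ha')
    (1 / 2) (by norm_num) (by norm_num)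
  have h2 := hg ((1 / 2 : ℝ) • a⁻¹ • d + (1 - 1 / 2 : ℝ) • a⁻¹ • c')
  simp only [map_add, map_smul, smul_eq_mul, hgd] at h2
  have h3 : a⁻¹ * a ≤ a⁻¹ * g c' := mul_le_mul_of_nonneg_left (by linarith) (by positivity)
  have h4 : a⁻¹ * a = 1 := inv_mul_cancel₀ ha0.ne'
  linarith

/-- Monotonicity of symmetric gauge functions, strict in the strictly convex case. -/
theorem IsSymmetricGauge.mono {q : ℕ} {Φ : Seminorm ℝ (Fin q → ℝ)}
    (hΦ : IsSymmetricGauge Φ) {d c : Fin q → ℝ} (hd : ∀ i, 0 ≤ d i) (hdc : ∀ i, d i ≤ c i) :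
    Φ d ≤ Φ c ∧ (IsStrictlyConvexGauge Φ → Φ d = Φ c → d = c) := by
  obtain ⟨h1, h2⟩ := hΦ.le_of_truncated_sums hd (fun i => (hd i).trans (hdc i)) (fun t _ =>
    Finset.sum_le_sum fun i _ => max_le_max (sub_le_sub_right (hdc i) t) le_rfl)
  refine ⟨h1, fun hs he => ?_⟩
  have h3 := (Finset.sum_eq_sum_iff_of_le (fun i _ => by gcongr; exacts [hd i, hdc i])).1 (h2 hs he)
  ext i
  exact (pow_left_inj₀ (hd i) ((hd i).trans (hdc i)) two_ne_zero).1 (h3 i (Finset.mem_univ i))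

end

/-! ### Eigenvalue inequalities for quadratic forms -/

noncomputable section

open Module in
/-- Weyl monotonicity, for quadratic forms diagonal in orthonormal bases with similarly ordered
eigenvalues. -/
theorem le_of_diagonal_forms_le {ι E : Type*} [Fintype ι] [NormedAddCommGroup E]
    [InnerProductSpace ℂ E] (e f : OrthonormalBasis ι ℂ E) {a b : ι → ℝ} (hab : Monovary a b)
    (h : ∀ x, ∑ i, a i * ‖inner ℂ (e i) x‖ ^ 2 ≤ ∑ i, b i * ‖inner ℂ (f i) x‖ ^ 2) (i : ι) :
    a i ≤ b i := by
  classical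
  by_contra! hi
  have : FiniteDimensional ℂ E := e.toBasis.finiteDimensional_of_finite
  -- Courant-Fischer argument: similar ordering makes `S` and `R` cover all indices, and `i` lies in
  -- both. The two spans thus have dimensions adding up to more than dim E and share a nonzero x, at
  -- which the forms are at least a i ‖x‖² and at most b i ‖x‖².
  let S : Finset ι := {j | a i ≤ a j}
  let R : Finset ι := {j | b j ≤ b i}
  let P := Submodule.span ℂ (Set.range fun j : S => e j)
  let Q := Submodule.span ℂ (Set.range fun j : R => f j)
  have hP : finrank ℂ P = S.card := by
    simpa using finrank_span_eq_card (R := ℂ) (b := fun j : S => e j)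
      (e.orthonormal.linearIndependent.comp _ Subtype.val_injective)
  have hQ : finrank ℂ Q = R.card := by
    simpa using finrank_span_eq_card (R := ℂ) (b := fun j : R => f j)
      (f.orthonormal.linearIndependent.comp _ Subtype.val_injective)
  have hcard : Fintype.card ι < S.card + R.card := by
    rw [← Finset.card_union_add_card_inter]
    have h1 : S ∪ R = Finset.univ := by
      ext j
      simp only [S, R, Finset.mem_union, Finset.mem_filter, Finset.mem_univ, true_and, iff_true]
      by_contra! hj
      exact absurd (hab hj.2) (not_le.2 hj.1)
    have h2 : 0 < (S ∩ R).card := Finset.card_pos.2 ⟨i, by simp [S, R]⟩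
    rw [h1, Finset.card_univ]
    omega
  have hE : finrank ℂ E = Fintype.card ι := finrank_eq_card_basis e.toBasis
  have hne : P ⊓ Q ≠ ⊥ := by
    intro hbot
    have h1 := Submodule.finrank_sup_add_finrank_inf_eq P Q
    have h2 := Submodule.finrank_le (P ⊔ Q)
    rw [hbot, finrank_bot] at h1
    omega
  obtain ⟨x, ⟨hxP, hxQ⟩, hx0⟩ := Submodule.exists_mem_ne_zero_of_ne_bot hne
  have hvan : ∀ (g : OrthonormalBasis ι ℂ E) (U : Finset ι),
      x ∈ Submodule.span ℂ (Set.range fun j : U => g j) → ∀ j ∉ U, inner ℂ (g j) x = 0 := by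
    intro g U hx j hj
    refine Submodule.span_induction (p := fun y _ => inner ℂ (g j) y = 0) ?_ ?_ ?_ ?_ hx
    · rintro _ ⟨k, rfl⟩
      exact g.orthonormal.inner_eq_zero fun hk => hj (hk ▸ k.2)
    · simp
    · intro y z _ _ hy hz; rw [inner_add_right, hy, hz, add_zero]
    · intro c y _ hy; rw [inner_smul_right, hy, mul_zero]
  have h1 : a i * ‖x‖ ^ 2 ≤ ∑ j, a j * ‖inner ℂ (e j) x‖ ^ 2 := by
    rw [← e.sum_sq_norm_inner_right x, Finset.mul_sum]
    refine Finset.sum_le_sum fun j _ => ?_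
    by_cases hj : j ∈ S
    · exact mul_le_mul_of_nonneg_right (by simpa [S] using hj) (by positivity)
    · simp [hvan e S hxP j hj]
  have h2 : ∑ j, b j * ‖inner ℂ (f j) x‖ ^ 2 ≤ b i * ‖x‖ ^ 2 := by
    rw [← f.sum_sq_norm_inner_right x, Finset.mul_sum]
    refine Finset.sum_le_sum fun j _ => ?_
    by_cases hj : j ∈ R
    · exact mul_le_mul_of_nonneg_right (by simpa [R] using hj) (by positivity)
    · simp [hvan f R hxQ j hj]
  have h3 : 0 < ‖x‖ ^ 2 := by positivity
  nlinarith [h x]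

open Module in
/-- A real combination of squared absolute values of functionals is diagonal in some orthonormal
basis; the trace is computed. -/
theorem exists_diagonal_form {κ E : Type*} [Fintype κ] [NormedAddCommGroup E]
    [InnerProductSpace ℂ E] [FiniteDimensional ℂ E] {N : ℕ} (hN : finrank ℂ E = N)
    (g : κ → E) (c : κ → ℝ) :
    ∃ (k : OrthonormalBasis (Fin N) ℂ E) (μ : Fin N → ℝ), Antitone μ ∧
      (∀ x, ∑ j, c j * ‖inner ℂ (g j) x‖ ^ 2 = ∑ i, μ i * ‖inner ℂ (k i) x‖ ^ 2) ∧
      ∑ i, μ i = ∑ j, c j * ‖g j‖ ^ 2 := by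
  let K : E →ₗ[ℂ] E := ∑ j, (c j : ℂ) • (InnerProductSpace.rankOne ℂ (g j) (g j)).toLinearMap
  have hK : ∀ x, K x = ∑ j, (c j : ℂ) • (inner ℂ (g j) x) • g j := by
    intro x; simp [K, LinearMap.sum_apply]
  have hsym : K.IsSymmetric := by
    intro x y
    simp only [hK, sum_inner, inner_sum, inner_smul_left, inner_smul_right, Complex.conj_ofReal,
      inner_conj_symm]
    exact Finset.sum_congr rfl fun j _ => by ring
  have hKx : ∀ x, (inner ℂ x (K x)).re = ∑ j, c j * ‖inner ℂ (g j) x‖ ^ 2 := by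
    intro x
    simp only [hK, inner_sum, inner_smul_right, Complex.re_sum]
    refine Finset.sum_congr rfl fun j _ => ?_
    rw [← inner_conj_symm x (g j), Complex.mul_conj, Complex.normSq_eq_norm_sq, ← Complex.ofReal_mul,
      Complex.ofReal_re]
  have hdiag : ∀ x, (inner ℂ x (K x)).re =
      ∑ i, hsym.eigenvalues hN i * ‖inner ℂ (hsym.eigenvectorBasis hN i) x‖ ^ 2 := by
    intro x
    rw [← (hsym.eigenvectorBasis hN).sum_inner_mul_inner x (K x), Complex.re_sum]
    refine Finset.sum_congr rfl fun i _ => ?_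
    rw [← hsym, hsym.apply_eigenvectorBasis, inner_smul_left, ← inner_conj_symm x]
    simp only [Complex.coe_algebraMap, Complex.conj_ofReal]
    rw [mul_left_comm, mul_comm ((starRingEnd ℂ) _), Complex.mul_conj, Complex.normSq_eq_norm_sq,
      ← Complex.ofReal_mul, Complex.ofReal_re]
  refine ⟨hsym.eigenvectorBasis hN, hsym.eigenvalues hN, hsym.eigenvalues_antitone hN,
    fun x => by rw [← hKx, hdiag], ?_⟩
  have h1 : ∀ i, hsym.eigenvalues hN i =
      ∑ j, c j * ‖inner ℂ (g j) (hsym.eigenvectorBasis hN i)‖ ^ 2 := by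
    intro i
    rw [← hKx, hsym.apply_eigenvectorBasis, inner_smul_right, inner_self_eq_norm_sq_to_K]
    simp
  rw [Finset.sum_congr rfl fun i _ => h1 i, Finset.sum_comm]
  refine Finset.sum_congr rfl fun j _ => ?_
  rw [← Finset.mul_sum, (hsym.eigenvectorBasis hN).sum_sq_norm_inner_left]

/-- Two similarly ordered families can be sorted simultaneously. -/
theorem exists_equiv_fin_monovary {ι : Type*} [Fintype ι] {N : ℕ} (hN : Fintype.card ι = N)
    {a b : ι → ℝ} (hab : Monovary a b) {μ : Fin N → ℝ} (hμ : Antitone μ) :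
    ∃ σ : ι ≃ Fin N, Monovary a (μ ∘ σ) ∧ Monovary b (μ ∘ σ) := by
  let τ := Fintype.equivFinOfCardEq hN
  -- Sorting by `a + b` sorts both families, since similarly ordered families cannot move in
  -- opposite directions.
  obtain ⟨ρ, hρ⟩ := exists_perm_antitone (fun i => (a + b) (τ.symm i))
  refine ⟨τ.trans ρ.symm, ?_⟩
  have key : ∀ i j, (μ ∘ τ.trans ρ.symm) i < (μ ∘ τ.trans ρ.symm) j → a i + b i ≤ a j + b j := by
    intro i j hij
    have h1 : ρ.symm (τ j) ≤ ρ.symm (τ i) := by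
      by_contra! h
      exact absurd (hμ h.le) (not_le.2 hij)
    simpa using hρ h1
  constructor
  · intro i j hij
    by_contra! h
    linarith [key i j hij, hab.symm h]
  · intro i j hij
    by_contra! h
    linarith [key i j hij, hab h]

/-- A perturbation bound: if one diagonal form exceeds another one by at most `t‖x‖²` plus a
nonnegative form, the truncated eigenvalue differences sum to at most the trace of that form. -/
theorem sum_truncated_le_trace {ι κ E : Type*} [Fintype ι] [Fintype κ] [NormedAddCommGroup E]
    [InnerProductSpace ℂ E] (e f : OrthonormalBasis ι ℂ E) {a b : ι → ℝ}
    (hab : Monovary a b) (p : κ → E) {γ : κ → ℝ} (hγ : ∀ j, 0 ≤ γ j) (t : ℝ)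
    (h : ∀ x, ∑ i, a i * ‖inner ℂ (e i) x‖ ^ 2 ≤ ∑ i, b i * ‖inner ℂ (f i) x‖ ^ 2 + t * ‖x‖ ^ 2 +
      ∑ j, γ j * ‖inner ℂ (p j) x‖ ^ 2) :
    ∑ i, max (a i - b i - t) 0 ≤ ∑ j, γ j * ‖p j‖ ^ 2 := by
  have : FiniteDimensional ℂ E := e.toBasis.finiteDimensional_of_finite
  -- The form of `b` plus the form of `γ` dominates both the form of `b` and that of `a - t`. Its
  -- eigenvalues therefore satisfy max (a i - b i - t) 0 ≤ μ i - b i, and the right-hand sides add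
  -- up to the trace of the form of `γ`.
  obtain ⟨k, μ, hμ, hform, htr⟩ := exists_diagonal_form
    (Module.finrank_eq_card_basis e.toBasis) (Sum.elim f p) (Sum.elim b γ)
  simp only [Fintype.sum_sum_type, Sum.elim_inl, Sum.elim_inr] at hform htr
  obtain ⟨σ, hσa, hσb⟩ := exists_equiv_fin_monovary rfl hab hμ
  have hk : ∀ x, ∑ i, (μ ∘ σ) i * ‖inner ℂ (k.reindex σ.symm i) x‖ ^ 2 =
      ∑ i, μ i * ‖inner ℂ (k i) x‖ ^ 2 := by
    intro x
    rw [← Equiv.sum_comp σ (fun i => μ i * ‖inner ℂ (k i) x‖ ^ 2)]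
    simp
  have hb : ∀ i, b i ≤ (μ ∘ σ) i := le_of_diagonal_forms_le f (k.reindex σ.symm) hσb fun x => by
    rw [hk, ← hform]
    exact le_add_of_nonneg_right (Finset.sum_nonneg fun j _ => mul_nonneg (hγ j) (by positivity))
  have ha : ∀ i, a i - t ≤ (μ ∘ σ) i := by
    refine le_of_diagonal_forms_le (a := fun i => a i - t) e (k.reindex σ.symm)
      (fun i j hij => sub_le_sub_right (hσa hij) t) fun x => ?_
    rw [hk, ← hform]
    simp only [sub_mul, Finset.sum_sub_distrib]
    rw [← Finset.mul_sum, e.sum_sq_norm_inner_right]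
    linarith [h x]
  have hsum : ∑ i, (μ ∘ σ) i = ∑ i, b i + ∑ j, γ j * ‖p j‖ ^ 2 := by
    have := Equiv.sum_comp σ μ
    simp only [Function.comp_apply]
    rw [this, htr]
    simp
  calc ∑ i, max (a i - b i - t) 0 ≤ ∑ i, ((μ ∘ σ) i - b i) :=
        Finset.sum_le_sum fun i _ => max_le (by linarith [ha i]) (by linarith [hb i])
    _ = _ := by rw [Finset.sum_sub_distrib, hsum]; ring

end

/-! ### Singular value decomposition, Hermitian dilation and Mirsky's inequality -/

noncomputable section

/-- `v 0, …, v (N-1)` is an orthonormal basis, and `v i = 0` for `i ≥ N`. -/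
def IsBasisSeq {V : Type*} [NormedAddCommGroup V] [InnerProductSpace ℂ V] (N : ℕ) (v : ℕ → V) :
    Prop :=
  ∃ b : OrthonormalBasis (Fin N) ℂ V, ∀ i, v i = if h : i < N then b ⟨i, h⟩ else 0

namespace IsBasisSeq

variable {V : Type*} [NormedAddCommGroup V] [InnerProductSpace ℂ V] {N : ℕ} {v : ℕ → V}

theorem eq_zero (hv : IsBasisSeq N v) {i : ℕ} (hi : N ≤ i) : v i = 0 := by
  obtain ⟨b, hb⟩ := hv
  rw [hb, dif_neg (by omega)]

theorem inner_eq (hv : IsBasisSeq N v) (i j : ℕ) :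
    inner ℂ (v i) (v j) = if i = j ∧ i < N then 1 else 0 := by
  by_cases hi : i < N
  · by_cases hj : j < N
    · obtain ⟨b, hb⟩ := hv
      rw [hb, hb, dif_pos hi, dif_pos hj, orthonormal_iff_ite.1 b.orthonormal]
      simp [hi]
    · rw [hv.eq_zero (not_lt.1 hj), inner_zero_right, if_neg (by omega)]
  · rw [hv.eq_zero (not_lt.1 hi), inner_zero_left, if_neg (by omega)]

theorem norm_eq_one (hv : IsBasisSeq N v) {i : ℕ} (hi : i < N) : ‖v i‖ = 1 := by
  have h := hv.inner_eq i i
  rw [if_pos ⟨rfl, hi⟩, inner_self_eq_norm_sq_to_K] at h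
  have h2 : ‖v i‖ ^ 2 = 1 := Complex.ofReal_injective (by simpa using h)
  nlinarith [norm_nonneg (v i)]

theorem norm_sq_le_one (hv : IsBasisSeq N v) (i : ℕ) : ‖v i‖ ^ 2 ≤ 1 := by
  by_cases hi : i < N
  · rw [hv.norm_eq_one hi, one_pow]
  · rw [hv.eq_zero (not_lt.1 hi)]
    norm_num

theorem sum_sq_norm_inner (hv : IsBasisSeq N v) (x : V) :
    ∑ i ∈ Finset.range N, ‖inner ℂ (v i) x‖ ^ 2 = ‖x‖ ^ 2 := by
  obtain ⟨b, hb⟩ := hv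
  rw [← Fin.sum_univ_eq_sum_range (fun i => ‖inner ℂ (v i) x‖ ^ 2), ← b.sum_sq_norm_inner_right x]
  simp [hb]

theorem sum_sq_norm_inner_le (hv : IsBasisSeq N v) (x : V) {q : ℕ} (hq : q ≤ N) :
    ∑ i ∈ Finset.range q, ‖inner ℂ (v i) x‖ ^ 2 ≤ ‖x‖ ^ 2 := by
  rw [← hv.sum_sq_norm_inner x]
  exact Finset.sum_le_sum_of_subset_of_nonneg (Finset.range_mono hq) fun _ _ _ => by positivity

theorem sum_inner_smul (hv : IsBasisSeq N v) (x : V) :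
    ∑ i ∈ Finset.range N, (inner ℂ (v i) x) • v i = x := by
  obtain ⟨b, hb⟩ := hv
  rw [← Fin.sum_univ_eq_sum_range (fun i => (inner ℂ (v i) x) • v i)]
  conv_rhs => rw [← b.sum_repr' x]
  simp [hb]

theorem linearMap_ext (hv : IsBasisSeq N v) {W : Type*} [AddCommGroup W] [Module ℂ W]
    {S T : V →ₗ[ℂ] W} (h : ∀ i, S (v i) = T (v i)) : S = T := by
  ext x
  rw [← hv.sum_inner_smul x, map_sum, map_sum]
  exact Finset.sum_congr rfl fun i _ => by rw [map_smul, map_smul, h]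

/-- Changing the signs of the vectors. -/
theorem signed (hv : IsBasisSeq N v) {ε : ℕ → ℝ} (hε : ∀ i, |ε i| = 1) :
    IsBasisSeq N (fun i => (ε i : ℂ) • v i) := by
  obtain ⟨b, hb⟩ := hv
  have hcard : Module.finrank ℂ V = N := by
    rw [Module.finrank_eq_card_basis b.toBasis, Fintype.card_fin]
  have hεε : ∀ i, ε i * ε i = 1 := fun i => by rw [← abs_mul_abs_self, hε, one_mul]
  have hon : Orthonormal ℂ (fun i : Fin N => (ε i : ℂ) • b i) := by
    rw [orthonormal_iff_ite]
    intro i j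
    rw [inner_smul_left, inner_smul_right, orthonormal_iff_ite.1 b.orthonormal,
      Complex.conj_ofReal]
    split_ifs with h
    · rw [h, mul_one]; exact_mod_cast hεε j
    · simp
  have : FiniteDimensional ℂ V := b.toBasis.finiteDimensional_of_finite
  refine ⟨OrthonormalBasis.mk hon ?_, fun i => ?_⟩
  · rw [hon.linearIndependent.span_eq_top_of_card_eq_finrank' (by rw [hcard, Fintype.card_fin])]
  · simp only [hb]
    split_ifs with h
    · simp
    · simp

end IsBasisSeq

variable {V W : Type*} [NormedAddCommGroup V] [InnerProductSpace ℂ V]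
  [NormedAddCommGroup W] [InnerProductSpace ℂ W]

/-- The orthonormal basis of `V × W` adapted to the Hermitian dilation of a map `V → W` that is
diagonal in the bases `v`, `u`. -/
theorem exists_dilation_basis {n m : ℕ} {v : ℕ → V} {u : ℕ → W} (hv : IsBasisSeq n v)
    (hu : IsBasisSeq m u) :
    ∃ e : OrthonormalBasis (Fin n ⊕ Fin m) ℂ (WithLp 2 (V × W)),
      ∀ s : ℕ → ℝ, (∀ i, min m n ≤ i → s i = 0) → ∀ p : WithLp 2 (V × W),
        ∑ i, Sum.elim (fun i : Fin n => s i) (fun j : Fin m => -s j) i * ‖inner ℂ (e i) p‖ ^ 2 =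
        ∑ i ∈ Finset.range (min m n),
          2 * s i * (inner ℂ (v i) p.fst * (starRingEnd ℂ) (inner ℂ (u i) p.snd)).re := by
  obtain ⟨b, -⟩ := id hv
  obtain ⟨b', -⟩ := id hu
  have hcV : Module.finrank ℂ V = n := by
    rw [Module.finrank_eq_card_basis b.toBasis, Fintype.card_fin]
  have hcW : Module.finrank ℂ W = m := by
    rw [Module.finrank_eq_card_basis b'.toBasis, Fintype.card_fin]
  have : FiniteDimensional ℂ V := b.toBasis.finiteDimensional_of_finite
  have : FiniteDimensional ℂ W := b'.toBasis.finiteDimensional_of_finite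
  have hcE : Module.finrank ℂ (WithLp 2 (V × W)) = n + m := by
    rw [(WithLp.linearEquiv 2 ℂ (V × W)).finrank_eq, Module.finrank_prod, hcV, hcW]
  obtain ⟨c, hcc, hcs⟩ : ∃ c : ℂ, c * c = 1 / 2 ∧ (starRingEnd ℂ) c = c := by
    refine ⟨((√2)⁻¹ : ℝ), ?_, Complex.conj_ofReal _⟩
    rw [← Complex.ofReal_mul, ← mul_inv, Real.mul_self_sqrt (by norm_num)]
    norm_num
  have hcn : ‖c‖ ^ 2 = 1 / 2 := by
    have h1 : ‖c * c‖ = 1 / 2 := by rw [hcc]; norm_num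
    rw [norm_mul] at h1
    rw [pow_two, h1]
  -- Eigenvectors of the dilation: (v i, ± u i)/√2 for i < min m n, completed by (v i, 0) or (0, u
  -- j). The latter carry the eigenvalue 0, as `s` vanishes from min m n on.
  let w : Fin n ⊕ Fin m → WithLp 2 (V × W) := Sum.elim
    (fun i => if i.val < m then WithLp.toLp 2 (c • v i, c • u i) else WithLp.toLp 2 (v i, 0))
    (fun j => if j.val < n then WithLp.toLp 2 (c • v j, -(c • u j)) else WithLp.toLp 2 (0, u j))
  have hw : Orthonormal ℂ w := by
    rw [orthonormal_iff_ite]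
    rintro (i | i) (j | j)
    · have hi := i.2
      by_cases h1 : i.val < m <;> by_cases h2 : j.val < m <;>
        simp only [w, Sum.elim_inl, h1, h2, if_true, if_false, WithLp.prod_inner_apply,
          inner_smul_left, inner_smul_right, hv.inner_eq, hu.inner_eq, hcs, inner_zero_left,
          inner_zero_right, hi, and_true, Sum.inl.injEq, Fin.ext_iff] <;>
        by_cases h3 : i.val = j.val <;> simp [h3] <;> first | omega | skip
      linear_combination 2 * hcc
    · have hi := i.2
      have hj := j.2
      by_cases h1 : i.val < m <;> by_cases h2 : j.val < n <;>
        simp only [w, Sum.elim_inl, Sum.elim_inr, h1, h2, if_true, if_false,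
          WithLp.prod_inner_apply, inner_neg_right,
          inner_smul_left, inner_smul_right, hv.inner_eq, hu.inner_eq, hcs, inner_zero_left,
          inner_zero_right, hi, and_true, reduceCtorEq] <;>
        by_cases h3 : i.val = j.val <;> simp [h3] <;> omega
    · have hi := i.2
      have hj := j.2
      by_cases h1 : i.val < n <;> by_cases h2 : j.val < m <;>
        simp only [w, Sum.elim_inl, Sum.elim_inr, h1, h2, if_true, if_false,
          WithLp.prod_inner_apply, inner_neg_left,
          inner_smul_left, inner_smul_right, hv.inner_eq, hu.inner_eq, hcs, inner_zero_left,
          inner_zero_right, hi, and_true, reduceCtorEq] <;>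
        by_cases h3 : i.val = j.val <;> simp [h3] <;> omega
    · have hi := i.2
      by_cases h1 : i.val < n <;> by_cases h2 : j.val < n <;>
        simp only [w, Sum.elim_inr, h1, h2, if_true, if_false, WithLp.prod_inner_apply,
          inner_smul_left, inner_smul_right, hv.inner_eq, hu.inner_eq, hcs, inner_zero_left,
          inner_neg_left, inner_neg_right,
          inner_zero_right, hi, and_true, Sum.inr.injEq, Fin.ext_iff] <;>
        by_cases h3 : i.val = j.val <;> simp [h3] <;> first | omega | skip
      linear_combination 2 * hcc
  refine ⟨OrthonormalBasis.mk hw ?_, fun s hs p => ?_⟩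
  · rw [hw.linearIndependent.span_eq_top_of_card_eq_finrank' (by simp [hcE])]
  simp only [OrthonormalBasis.coe_mk, Fintype.sum_sum_type, Sum.elim_inl, Sum.elim_inr]
  have h1 : ∀ i < min m n, ‖inner ℂ (WithLp.toLp 2 (c • v i, c • u i)) p‖ ^ 2 =
      1 / 2 * ‖inner ℂ (v i) p.fst + inner ℂ (u i) p.snd‖ ^ 2 := by
    intro i hi
    simp only [WithLp.prod_inner_apply, inner_smul_left, hcs, ← mul_add, norm_mul, mul_pow, hcn]
    rfl
  have h2 : ∀ i < min m n, ‖inner ℂ (WithLp.toLp 2 (c • v i, -(c • u i))) p‖ ^ 2 =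
      1 / 2 * ‖inner ℂ (v i) p.fst - inner ℂ (u i) p.snd‖ ^ 2 := by
    intro i hi
    simp only [WithLp.prod_inner_apply, inner_smul_left, inner_neg_left, hcs, ← sub_eq_add_neg,
      ← mul_sub, norm_mul, mul_pow, hcn]
    rfl
  have hred : ∀ (N : ℕ) (_ : min m n ≤ N) (G : Fin N → ℝ) (G' : ℕ → ℝ),
      (∀ i : Fin N, i.val < min m n → G i = G' i) →
      ∑ i : Fin N, s i * G i = ∑ i ∈ Finset.range (min m n), s i * G' i := by
    intro N hN G G' hG
    have h3 : ∀ i : Fin N, s i * G i = (fun j : ℕ => s j * G' j) i := by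
      intro i
      by_cases hi : i.val < min m n
      · simp only [hG i hi]
      · simp only [hs i (not_lt.1 hi), zero_mul]
    rw [Finset.sum_congr rfl fun i _ => h3 i, Fin.sum_univ_eq_sum_range (fun j : ℕ => s j * G' j)]
    refine (Finset.sum_subset (Finset.range_mono hN) fun i _ hi => ?_).symm
    rw [hs i (not_lt.1 (mt Finset.mem_range.2 hi)), zero_mul]
  simp only [neg_mul, Finset.sum_neg_distrib]
  rw [hred n (min_le_right m n) _
      (fun i => 1 / 2 * ‖inner ℂ (v i) p.fst + inner ℂ (u i) p.snd‖ ^ 2) fun i hi => by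
        rw [← h1 i hi]; simp [w, (lt_min_iff.1 hi).1],
    hred m (min_le_left m n) _
      (fun i => 1 / 2 * ‖inner ℂ (v i) p.fst - inner ℂ (u i) p.snd‖ ^ 2) fun i hi => by
        rw [← h2 i hi]; simp [w, (lt_min_iff.1 hi).2],
    ← sub_eq_add_neg, ← Finset.sum_sub_distrib]
  refine Finset.sum_congr rfl fun i _ => ?_
  rw [Complex.sq_norm, Complex.sq_norm, Complex.normSq_add, Complex.normSq_sub]
  ring

/-- `v`, `u` are orthonormal bases (extended by zero) in which `T` is diagonal, with its singular
values on the diagonal. -/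
structure IsSVD [FiniteDimensional ℂ V] [FiniteDimensional ℂ W] (T : V →ₗ[ℂ] W) (n m : ℕ)
    (v : ℕ → V) (u : ℕ → W) : Prop where
  left : IsBasisSeq n v
  right : IsBasisSeq m u
  apply_left : ∀ i, T (v i) = (T.singularValues i : ℂ) • u i

/-- The map with diagonal entries `c 0, …, c (q-1)` in `v`, `u` has a dilation whose quadratic form
is bounded by `t‖·‖²` plus a form of trace `∑ max (c j - t) 0`. -/
theorem two_mul_re_le_truncated {n m q : ℕ} {v : ℕ → V} {u : ℕ → W} (hv : IsBasisSeq n v)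
    (hu : IsBasisSeq m u) (hqn : q ≤ n) (hqm : q ≤ m) {c : ℕ → ℝ} (hc : ∀ j, 0 ≤ c j) {t : ℝ}
    (ht : 0 ≤ t) (x : V) (y : W) :
    ∑ j ∈ Finset.range q, 2 * c j * (inner ℂ (v j) x * (starRingEnd ℂ) (inner ℂ (u j) y)).re ≤
      t * (‖x‖ ^ 2 + ‖y‖ ^ 2) +
      ∑ j ∈ Finset.range q,
        max (c j - t) 0 * (1 / 2 * ‖inner ℂ (v j) x + inner ℂ (u j) y‖ ^ 2) := by
  have h1 := add_le_add (hv.sum_sq_norm_inner_le x hqn) (hu.sum_sq_norm_inner_le y hqm)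
  rw [← Finset.sum_add_distrib] at h1
  refine le_trans ?_ (add_le_add_left (mul_le_mul_of_nonneg_left h1 ht) _)
  rw [Finset.mul_sum, ← Finset.sum_add_distrib]
  refine Finset.sum_le_sum fun j _ => ?_
  have hp := Complex.normSq_add (inner ℂ (v j) x) (inner ℂ (u j) y)
  have hm := Complex.normSq_sub (inner ℂ (v j) x) (inner ℂ (u j) y)
  have hp0 := Complex.normSq_nonneg (inner ℂ (v j) x + inner ℂ (u j) y)
  have hm0 := Complex.normSq_nonneg (inner ℂ (v j) x - inner ℂ (u j) y)
  simp only [Complex.sq_norm]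
  rw [hp] at hp0 ⊢
  rw [hm] at hm0
  have hcj := hc j
  -- With a, b the two inner products, the slack is (c + t)/2 · |a - b|² if t ≤ c, and c |a - b|² +
  -- (t - c)(|a|² + |b|²) otherwise.
  rcases le_total t (c j) with h | h
  · rw [max_eq_left (sub_nonneg.2 h)]
    nlinarith
  · rw [max_eq_right (sub_nonpos.2 h)]
    nlinarith [mul_nonneg hcj hm0, mul_nonneg (sub_nonneg.2 h)
      (add_nonneg (Complex.normSq_nonneg (inner ℂ (v j) x))
        (Complex.normSq_nonneg (inner ℂ (u j) y)))]

theorem IsBasisSeq.finrank_eq {N : ℕ} {v : ℕ → V} (hv : IsBasisSeq N v) :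
    Module.finrank ℂ V = N := by
  obtain ⟨b, -⟩ := hv
  rw [Module.finrank_eq_card_basis b.toBasis, Fintype.card_fin]

theorem two_mul_re_inner_sum_smul (q : ℕ) (c : ℕ → ℝ) (v : ℕ → V) (u : ℕ → W) (x : V) (y : W) :
    2 * (inner ℂ y (∑ i ∈ Finset.range q, (c i : ℂ) • (inner ℂ (v i) x) • u i)).re =
    ∑ i ∈ Finset.range q, 2 * c i * (inner ℂ (v i) x * (starRingEnd ℂ) (inner ℂ (u i) y)).re := by
  rw [inner_sum, Complex.re_sum, Finset.mul_sum]
  refine Finset.sum_congr rfl fun i _ => ?_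
  rw [inner_smul_right, inner_smul_right, inner_conj_symm, Complex.re_ofReal_mul]
  ring

section FiniteDim

variable [FiniteDimensional ℂ V] [FiniteDimensional ℂ W]

theorem singularValues_eq_zero_of_min_le {n m : ℕ} (hn : Module.finrank ℂ V = n)
    (hm : Module.finrank ℂ W = m) (T : V →ₗ[ℂ] W) {i : ℕ} (hi : min m n ≤ i) :
    T.singularValues i = 0 := by
  rw [T.singularValues_eq_zero_iff_le_finrank_range]
  have h1 := Submodule.finrank_le (LinearMap.range T)
  have h2 := T.finrank_range_le
  omega

/-- Every linear map has a singular value decomposition. -/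
theorem exists_isSVD {n m : ℕ} (hn : Module.finrank ℂ V = n) (hm : Module.finrank ℂ W = m)
    (T : V →ₗ[ℂ] W) : ∃ v u, IsSVD T n m v u := by
  let b := T.isSymmetric_adjoint_comp_self.eigenvectorBasis hn
  have hb : ∀ i, LinearMap.adjoint T (T (b i)) = ((T.singularValues i ^ 2 : ℝ) : ℂ) • b i := by
    intro i
    have := T.isSymmetric_adjoint_comp_self.apply_eigenvectorBasis hn i
    rw [← T.sq_singularValues_fin hn] at this
    exact this
  have hTT : ∀ i j, inner ℂ (T (b i)) (T (b j)) =
      if i = j then ((T.singularValues i ^ 2 : ℝ) : ℂ) else 0 := by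
    intro i j
    rw [← LinearMap.adjoint_inner_left, hb, inner_smul_left, orthonormal_iff_ite.1 b.orthonormal,
      Complex.conj_ofReal]
    simp
  let v : ℕ → V := fun i => if h : i < n then b ⟨i, h⟩ else 0
  -- The normalized images of the eigenvectors of T*T are orthonormal where the singular value is
  -- nonzero; at the other indices any orthonormal completion serves.
  let w : Fin m → W := fun i => ((T.singularValues i)⁻¹ : ℂ) • T (v i)
  let S : Set (Fin m) := {i | T.singularValues i ≠ 0}
  have hSn : ∀ i : Fin m, i ∈ S → i.val < n := by
    intro i hi
    by_contra! h
    exact hi (singularValues_eq_zero_of_min_le hn hm T (le_trans (min_le_right m n) h))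
  have hon : Orthonormal ℂ (S.domRestrict w) := by
    rw [orthonormal_iff_ite]
    rintro ⟨i, hi⟩ ⟨j, hj⟩
    have hi0 : (T.singularValues i : ℂ) ≠ 0 := by exact_mod_cast hi
    have hwb : ∀ k (hk : k ∈ S),
        w k = ((T.singularValues k : ℂ))⁻¹ • T (b ⟨k, hSn k hk⟩) := fun k hk => by
      simp only [w, v, dif_pos (hSn k hk)]
    change inner ℂ (w i) (w j) = _
    rw [hwb i hi, hwb j hj, inner_smul_left, inner_smul_right, hTT]
    by_cases hij : i = j
    · subst hij
      simp
      field_simp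
    · have : i.val ≠ j.val := fun h => hij (Fin.ext h)
      simp [hij, this]
  obtain ⟨b', hb'⟩ := hon.exists_orthonormalBasis_extension_of_card_eq (by simp [hm])
  refine ⟨v, fun i => if h : i < m then b' ⟨i, h⟩ else 0, ⟨b, fun i => rfl⟩, ⟨b', fun i => rfl⟩,
    fun i => ?_⟩
  by_cases hs : T.singularValues i = 0
  · rw [hs]
    simp only [Complex.ofReal_zero, zero_smul]
    by_cases hi : i < n
    · have h1 := hTT ⟨i, hi⟩ ⟨i, hi⟩
      simp only [if_true, hs] at h1
      simpa [v, hi] using h1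
    · simp [v, hi]
  · have him : i < m := by
      by_contra! h
      exact hs (singularValues_eq_zero_of_min_le hn hm T (le_trans (min_le_left m n) h))
    rw [dif_pos him, hb' ⟨i, him⟩ hs]
    simp only [w]
    rw [smul_smul, mul_inv_cancel₀ (by exact_mod_cast hs), one_smul]

theorem IsSVD.apply_eq {n m : ℕ} {T : V →ₗ[ℂ] W} {v : ℕ → V} {u : ℕ → W} (h : IsSVD T n m v u)
    (x : V) : T x = ∑ i ∈ Finset.range (min m n),
      (T.singularValues i : ℂ) • (inner ℂ (v i) x) • u i := by
  conv_lhs => rw [← h.left.sum_inner_smul x, map_sum]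
  rw [← Finset.sum_subset (Finset.range_mono (min_le_right m n))]
  · exact Finset.sum_congr rfl fun i _ => by rw [map_smul, h.apply_left, smul_comm]
  · intro i _ hi
    rw [map_smul, h.apply_left, singularValues_eq_zero_of_min_le h.left.finrank_eq
      h.right.finrank_eq T (not_lt.1 (mt Finset.mem_range.2 hi))]
    simp

/-- The eigenvalues of any two dilations are similarly ordered, so Weyl monotonicity compares s_i
with s'_i and -s_j with -s'_j. -/
theorem monovary_dilation_eigenvalues {n m : ℕ} {s s' : ℕ → ℝ} (hs : Antitone s)
    (hs0 : ∀ i, 0 ≤ s i) (hs' : Antitone s') (hs0' : ∀ i, 0 ≤ s' i) :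
    Monovary (Sum.elim (fun i : Fin n => s i) (fun j : Fin m => -s j))
      (Sum.elim (fun i : Fin n => s' i) (fun j : Fin m => -s' j)) := by
  rintro (i | i) (j | j) h <;> simp only [Sum.elim_inl, Sum.elim_inr] at h ⊢
  · refine hs ?_
    by_contra! hij
    exact absurd (hs' hij.le) (not_le.2 h)
  · linarith [hs0' i, hs0' j]
  · linarith [hs0 i, hs0 j]
  · refine neg_le_neg (hs ?_)
    by_contra! hij
    linarith [hs' hij.le]

/-- Mirsky's inequality in terms of truncated sums: if `T - S` is diagonal with entries `c j ≥ 0`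
in some orthonormal bases, the differences of the singular values of `T` and `S` are weakly
majorized by `c`. -/
theorem sum_truncated_abs_sub_singularValues_le {n m : ℕ} {T S : V →ₗ[ℂ] W} {z : ℕ → V}
    {w : ℕ → W} (hz : IsBasisSeq n z) (hw : IsBasisSeq m w) {c : ℕ → ℝ} (hc : ∀ j, 0 ≤ c j)
    (h : ∀ x, T x - S x = ∑ j ∈ Finset.range (min m n), (c j : ℂ) • (inner ℂ (z j) x) • w j)
    {t : ℝ} (ht : 0 ≤ t) :
    ∑ i : Fin (min m n), max (|T.singularValues i - S.singularValues i| - t) 0 ≤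
      ∑ i : Fin (min m n), max (c i - t) 0 := by
  have hn := hz.finrank_eq
  have hm := hw.finrank_eq
  obtain ⟨v, u, hT⟩ := exists_isSVD hn hm T
  obtain ⟨v', u', hS⟩ := exists_isSVD hn hm S
  obtain ⟨e, he⟩ := exists_dilation_basis hT.left hT.right
  obtain ⟨f, hf⟩ := exists_dilation_basis hS.left hS.right
  obtain ⟨r, hr, hrr⟩ : ∃ r : ℂ, ‖r‖ ^ 2 = 1 / 2 ∧ (starRingEnd ℂ) r = r := by
    refine ⟨((√2)⁻¹ : ℝ), ?_, Complex.conj_ofReal _⟩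
    rw [Complex.norm_real, Real.norm_eq_abs, sq_abs, inv_pow, Real.sq_sqrt (by norm_num)]
    norm_num
  -- Unit vectors, so the form with weights max (c j - t) 0 has exactly the trace wanted.
  let p : Fin (min m n) → WithLp 2 (V × W) := fun j => WithLp.toLp 2 (r • z j, r • w j)
  have hp : ∀ j, ‖p j‖ ^ 2 = 1 := by
    intro j
    have hj := lt_min_iff.1 j.2
    rw [WithLp.prod_norm_sq_eq_of_L2]
    change ‖r • z j‖ ^ 2 + ‖r • w j‖ ^ 2 = 1
    rw [norm_smul, norm_smul, mul_pow, mul_pow, hz.norm_eq_one hj.2, hw.norm_eq_one hj.1, hr]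
    norm_num
  have key := sum_truncated_le_trace e f
    (monovary_dilation_eigenvalues (n := n) (m := m) T.singularValues_antitone
      T.singularValues_nonneg S.singularValues_antitone S.singularValues_nonneg) p
    (γ := fun j => max (c j - t) 0) (fun j => le_max_right _ _) t (fun x => by
      rw [he _ (fun i hi => singularValues_eq_zero_of_min_le hn hm T hi),
        hf _ (fun i hi => singularValues_eq_zero_of_min_le hn hm S hi),
        ← two_mul_re_inner_sum_smul, ← two_mul_re_inner_sum_smul, ← hT.apply_eq, ← hS.apply_eq]
      have h1 := two_mul_re_le_truncated hz hw (min_le_right m n) (min_le_left m n) hc ht x.fst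
        x.snd
      rw [← two_mul_re_inner_sum_smul, ← h, inner_sub_right, Complex.sub_re] at h1
      rw [WithLp.prod_norm_sq_eq_of_L2]
      have h2 : ∀ j : Fin (min m n), ‖inner ℂ (p j) x‖ ^ 2 =
          1 / 2 * ‖inner ℂ (z j) x.fst + inner ℂ (w j) x.snd‖ ^ 2 := by
        intro j
        simp only [p, WithLp.prod_inner_apply, inner_smul_left, hrr, ← mul_add, norm_mul, mul_pow,
          hr]
        rfl
      rw [← Fin.sum_univ_eq_sum_range (fun j => max (c j - t) 0 *
        (1 / 2 * ‖inner ℂ (z j) x.fst + inner ℂ (w j) x.snd‖ ^ 2))] at h1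
      simp only [h2]
      linarith)
  simp only [hp, mul_one, Fintype.sum_sum_type, Sum.elim_inl, Sum.elim_inr] at key
  refine le_trans ?_ key
  have hle : ∀ (N : ℕ) (_ : min m n ≤ N) (g : ℕ → ℝ), (∀ i, 0 ≤ g i) →
      ∑ i : Fin (min m n), g i ≤ ∑ i : Fin N, g i := by
    intro N hN g hg
    rw [Fin.sum_univ_eq_sum_range, Fin.sum_univ_eq_sum_range]
    exact Finset.sum_le_sum_of_subset_of_nonneg (Finset.range_mono hN) fun i _ _ => hg i
  -- The eigenvalues s_i contribute the positive part of s_i - s'_i - t, the eigenvalues -s_i that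
  -- of s'_i - s_i - t; together they cover the absolute value.
  refine le_trans ?_ (add_le_add
    (hle n (min_le_right m n) (fun i => max (T.singularValues i - S.singularValues i - t) 0)
      fun i => le_max_right _ _)
    (hle m (min_le_left m n) (fun i => max (-T.singularValues i - -S.singularValues i - t) 0)
      fun i => le_max_right _ _))
  rw [← Finset.sum_add_distrib]
  refine Finset.sum_le_sum fun i _ => ?_
  rcases abs_cases ((T.singularValues i : ℝ) - S.singularValues i) with ⟨h1, -⟩ | ⟨h1, -⟩ <;> rw [h1]
  · exact le_add_of_nonneg_right (le_max_right _ _)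
  · refine le_trans (le_of_eq ?_) (le_add_of_nonneg_left (le_max_right _ _))
    congr 1
    ring

end FiniteDim

end

/-! ### Diagonal maps, partial isometries and rigidity in the Frobenius norm -/

noncomputable section

section DiagMap

variable {V W : Type*} [NormedAddCommGroup V] [InnerProductSpace ℂ V]
  [NormedAddCommGroup W] [InnerProductSpace ℂ W]

/-- The linear map with diagonal entries `c 0, …, c (q-1)` with respect to `v` and `u`. -/
def diagMap (q : ℕ) (v : ℕ → V) (u : ℕ → W) (c : ℕ → ℝ) : V →ₗ[ℂ] W :=
  ∑ i ∈ Finset.range q, (c i : ℂ) • (InnerProductSpace.rankOne ℂ (u i) (v i)).toLinearMap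

theorem diagMap_apply (q : ℕ) (v : ℕ → V) (u : ℕ → W) (c : ℕ → ℝ) (x : V) :
    diagMap q v u c x = ∑ i ∈ Finset.range q, (c i : ℂ) • (inner ℂ (v i) x) • u i := by
  simp [diagMap, LinearMap.sum_apply]

theorem diagMap_apply_basis {n q : ℕ} {v : ℕ → V} (hv : IsBasisSeq n v) (hq : q ≤ n) (u : ℕ → W)
    (c : ℕ → ℝ) (i : ℕ) : diagMap q v u c (v i) = if i < q then (c i : ℂ) • u i else 0 := by
  rw [diagMap_apply]
  split_ifs with h
  · rw [Finset.sum_eq_single_of_mem i (Finset.mem_range.2 h)]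
    · rw [hv.inner_eq, if_pos ⟨rfl, by omega⟩, one_smul]
    · intro j _ hj
      rw [hv.inner_eq, if_neg (by tauto)]
      simp
  · refine Finset.sum_eq_zero fun j hj => ?_
    have := Finset.mem_range.1 hj
    rw [hv.inner_eq, if_neg (by omega)]
    simp

theorem norm_sq_diagMap {m q : ℕ} (v : ℕ → V) {u : ℕ → W} (hu : IsBasisSeq m u) (hq : q ≤ m)
    (c : ℕ → ℝ) (x : V) :
    ‖diagMap q v u c x‖ ^ 2 = ∑ i ∈ Finset.range q, c i ^ 2 * ‖inner ℂ (v i) x‖ ^ 2 := by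
  rw [← hu.sum_sq_norm_inner]
  have h1 : ∀ j, inner ℂ (u j) (diagMap q v u c x) =
      if j < q then (c j : ℂ) * inner ℂ (v j) x else 0 := by
    intro j
    rw [diagMap_apply, inner_sum]
    split_ifs with h
    · rw [Finset.sum_eq_single_of_mem j (Finset.mem_range.2 h)]
      · rw [inner_smul_right, inner_smul_right, hu.inner_eq, if_pos ⟨rfl, by omega⟩, mul_one]
      · intro i _ hi
        rw [inner_smul_right, inner_smul_right, hu.inner_eq, if_neg (by tauto)]
        simp
    · refine Finset.sum_eq_zero fun i hi => ?_
      have := Finset.mem_range.1 hi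
      rw [inner_smul_right, inner_smul_right, hu.inner_eq, if_neg (by omega)]
      simp
  rw [← Finset.sum_subset (Finset.range_mono hq)]
  · refine Finset.sum_congr rfl fun j hj => ?_
    rw [h1, if_pos (Finset.mem_range.1 hj), norm_mul, mul_pow, Complex.norm_real, Real.norm_eq_abs,
      sq_abs]
  · intro j _ hj
    rw [h1, if_neg (mt Finset.mem_range.2 hj)]
    simp

theorem diagMap_eq_zero_iff {m q : ℕ} (v : ℕ → V) {u : ℕ → W} (hu : IsBasisSeq m u) (hq : q ≤ m)
    (c : ℕ → ℝ) (x : V) :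
    diagMap q v u c x = 0 ↔ ∀ i < q, c i ≠ 0 → inner ℂ (v i) x = 0 := by
  rw [← norm_eq_zero, ← sq_eq_zero_iff, norm_sq_diagMap v hu hq,
    Finset.sum_eq_zero_iff_of_nonneg fun i _ => by positivity]
  simp only [Finset.mem_range, mul_eq_zero, sq_eq_zero_iff, norm_eq_zero]
  exact forall₂_congr fun i _ => or_iff_not_imp_left

/-- The indicator of `i < k`, the singular values of a partial isometry of rank `k`. -/
def stepSeq (k i : ℕ) : ℝ := if i < k then 1 else 0

/-- The partial isometry mapping `v i` to `u i` for `i < k`. -/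
abbrev truncMap (q k : ℕ) (v : ℕ → V) (u : ℕ → W) : V →ₗ[ℂ] W := diagMap q v u (stepSeq k)

theorem truncMap_apply_basis {n q k : ℕ} {v : ℕ → V} (hv : IsBasisSeq n v) (hq : q ≤ n)
    (hk : k ≤ q) (u : ℕ → W) (i : ℕ) : truncMap q k v u (v i) = if i < k then u i else 0 := by
  rw [diagMap_apply_basis hv hq]
  unfold stepSeq
  split_ifs <;> first | omega | simp

theorem finrank_range_truncMap {n m q k : ℕ} {v : ℕ → V} {u : ℕ → W} (hv : IsBasisSeq n v)
    (hu : IsBasisSeq m u) (hqn : q ≤ n) (hqm : q ≤ m) (hk : k ≤ q) :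
    Module.finrank ℂ (LinearMap.range (truncMap q k v u)) = k := by
  have hon : Orthonormal ℂ (fun i : Fin k => u i) := by
    rw [orthonormal_iff_ite]
    intro i j
    rw [hu.inner_eq]
    have := i.2
    refine if_congr ⟨fun h => Fin.ext h.1, fun h => ⟨by rw [h], by omega⟩⟩ rfl rfl
  have h : LinearMap.range (truncMap q k v u) =
      Submodule.span ℂ (Set.range fun i : Fin k => u i) := by
    apply le_antisymm
    · rintro _ ⟨x, rfl⟩
      rw [← hv.sum_inner_smul x, map_sum]
      refine Submodule.sum_mem _ fun i _ => ?_
      rw [map_smul, truncMap_apply_basis hv hqn hk]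
      refine Submodule.smul_mem _ _ ?_
      split_ifs with hi
      · exact Submodule.subset_span ⟨⟨i, hi⟩, rfl⟩
      · exact Submodule.zero_mem _
    · rw [Submodule.span_le]
      rintro _ ⟨i, rfl⟩
      exact ⟨v i, by rw [truncMap_apply_basis hv hqn hk, if_pos i.2]⟩
  rw [h, finrank_span_eq_card hon.linearIndependent, Fintype.card_fin]

theorem norm_truncMap_of_mem_orthogonal_ker {n m q k : ℕ} {v : ℕ → V} {u : ℕ → W}
    (hv : IsBasisSeq n v) (hu : IsBasisSeq m u) (hqn : q ≤ n) (hqm : q ≤ m) (hk : k ≤ q) (f : V)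
    (hf : f ∈ (LinearMap.ker (truncMap q k v u))ᗮ) : ‖truncMap q k v u f‖ = ‖f‖ := by
  rw [← pow_left_inj₀ (norm_nonneg _) (norm_nonneg _) two_ne_zero, norm_sq_diagMap v hu hqm,
    ← hv.sum_sq_norm_inner f, ← Finset.sum_subset (Finset.range_mono hqn)]
  · refine Finset.sum_congr rfl fun i _ => ?_
    unfold stepSeq
    split_ifs with hi
    · simp
    · rw [(Submodule.mem_orthogonal _ _).1 hf (v i)
        (by rw [LinearMap.mem_ker, truncMap_apply_basis hv hqn hk, if_neg hi])]
      simp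
  · intro i _ hi
    have := mt Finset.mem_range.2 hi
    rw [(Submodule.mem_orthogonal _ _).1 hf (v i)
      (by rw [LinearMap.mem_ker, truncMap_apply_basis hv hqn hk, if_neg (by omega)])]
    simp

variable [FiniteDimensional ℂ V] [FiniteDimensional ℂ W]

theorem IsSVD.eq_diagMap {n m : ℕ} {T : V →ₗ[ℂ] W} {v : ℕ → V} {u : ℕ → W}
    (h : IsSVD T n m v u) : T = diagMap (min m n) v u T.singularValues := by
  ext x
  rw [diagMap_apply, h.apply_eq]

theorem IsSVD.singularValues_eq_zero {n m : ℕ} {T : V →ₗ[ℂ] W} {v : ℕ → V} {u : ℕ → W}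
    (h : IsSVD T n m v u) {i : ℕ} (hi : min m n ≤ i) : T.singularValues i = 0 :=
  singularValues_eq_zero_of_min_le h.left.finrank_eq h.right.finrank_eq T hi

/-- The singular values of a partial isometry. -/
theorem singularValues_of_partialIsometry (T : V →ₗ[ℂ] W)
    (hT : ∀ f ∈ (LinearMap.ker T)ᗮ, ‖T f‖ = ‖f‖) (i : ℕ) :
    T.singularValues i = stepSeq (Module.finrank ℂ (LinearMap.range T)) i := by
  unfold stepSeq
  split_ifs with hi
  · obtain ⟨v, u, h⟩ := exists_isSVD rfl rfl T
    have hs := T.singularValues_pos_iff_lt_finrank_range.2 hi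
    have hiq : i < min (Module.finrank ℂ W) (Module.finrank ℂ V) := by
      by_contra! hle
      exact hs.ne' (h.singularValues_eq_zero hle)
    -- A right singular vector with nonzero singular value is orthogonal to the kernel, so its norm
    -- is preserved.
    have h1 := hT (v i) ((Submodule.mem_orthogonal _ _).2 fun x hx => by
      rw [LinearMap.mem_ker, h.eq_diagMap, diagMap_eq_zero_iff v h.right (min_le_left _ _)] at hx
      rw [← inner_conj_symm, hx i hiq hs.ne', map_zero])
    rw [h.apply_left, norm_smul, h.left.norm_eq_one (lt_min_iff.1 hiq).2,
      h.right.norm_eq_one (lt_min_iff.1 hiq).1, mul_one, Complex.norm_real, Real.norm_eq_abs,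
      abs_of_pos hs] at h1
    exact h1
  · exact T.singularValues_eq_zero_iff_le_finrank_range.2 (not_lt.1 hi)

/-- The Frobenius norm computed in an arbitrary orthonormal basis. -/
theorem sum_sq_singularValues {n m : ℕ} (hm : Module.finrank ℂ W = m) {z : ℕ → V}
    (hz : IsBasisSeq n z) (T : V →ₗ[ℂ] W) :
    ∑ i ∈ Finset.range (min m n), T.singularValues i ^ 2 =
      ∑ i ∈ Finset.range n, ‖T (z i)‖ ^ 2 := by
  obtain ⟨v, u, h⟩ := exists_isSVD hz.finrank_eq hm T
  have h1 : ∀ x, ‖T x‖ ^ 2 =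
      ∑ i ∈ Finset.range (min m n), T.singularValues i ^ 2 * ‖inner ℂ (v i) x‖ ^ 2 := by
    intro x
    rw [← norm_sq_diagMap v h.right (min_le_left _ _), ← h.eq_diagMap]
  rw [Finset.sum_congr rfl fun i _ => h1 (z i), Finset.sum_comm]
  refine Finset.sum_congr rfl fun j hj => ?_
  rw [← Finset.mul_sum, Finset.sum_congr rfl fun i _ => by rw [norm_inner_symm],
    hz.sum_sq_norm_inner, h.left.norm_eq_one (lt_min_iff.1 (Finset.mem_range.1 hj)).2]
  simp

theorem sum_stepSeq {q k : ℕ} (hk : k ≤ q) : ∑ i ∈ Finset.range q, stepSeq k i = k := by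
  rw [← Finset.sum_subset (Finset.range_mono hk)]
  · rw [Finset.sum_congr rfl fun i hi => show stepSeq k i = 1 from if_pos (Finset.mem_range.1 hi)]
    simp
  · intro i _ hi
    exact if_neg (mt Finset.mem_range.2 hi)

theorem stepSeq_sq (k i : ℕ) : stepSeq k i ^ 2 = stepSeq k i := by
  unfold stepSeq; split_ifs <;> norm_num

/-- Equality in the trace inequality: a partial isometry of rank `k` attaining the Frobenius bound
is the truncated singular value decomposition if there is a gap after the `k`-th singular value. -/
theorem apply_eq_of_sum_sq_singularValues_sub {n m k : ℕ} {T X : V →ₗ[ℂ] W} {v : ℕ → V}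
    {u : ℕ → W} (hT : IsSVD T n m v u) (hX : ∀ i, X.singularValues i = stepSeq k i) (hk : 1 ≤ k)
    (hgap : T.singularValues k < T.singularValues (k - 1))
    (hF : ∑ i ∈ Finset.range (min m n), (T - X).singularValues i ^ 2 =
      ∑ i ∈ Finset.range (min m n), (T.singularValues i - stepSeq k i) ^ 2) (i : ℕ) :
    X (v i) = if i < k then u i else 0 := by
  have hn := hT.left.finrank_eq
  have hm := hT.right.finrank_eq
  obtain ⟨z, w, hS⟩ := exists_isSVD hn hm X
  have hs0 := T.singularValues_nonneg
  have hkq : k ≤ min m n := by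
    by_contra! h
    have h1 := hT.singularValues_eq_zero (i := k - 1) (by omega)
    linarith [hs0 k]
  set q := min m n with hq
  have hqn : q ≤ n := min_le_right _ _
  have hqm : q ≤ m := min_le_left _ _
  have hXd : X = diagMap q z w (stepSeq k) := by
    have h1 := hS.eq_diagMap
    rwa [funext hX] at h1
  -- Here P i = ‖X v_i‖² and Q i = ‖X* u_i‖². Both are at most 1 and have total k, and c i = Re
  -- ⟨u_i, X v_i⟩ is at most their mean g i.
  let P : ℕ → ℝ := fun i => ‖X (v i)‖ ^ 2
  let Q : ℕ → ℝ := fun i => ∑ j ∈ Finset.range q, stepSeq k j * ‖inner ℂ (w j) (u i)‖ ^ 2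
  let c : ℕ → ℝ := fun i => (inner ℂ (u i) (X (v i))).re
  let g : ℕ → ℝ := fun i => (P i + Q i) / 2
  have hst0 : ∀ j, 0 ≤ stepSeq k j := fun j => by unfold stepSeq; split_ifs <;> norm_num
  have hst1 : ∀ j, stepSeq k j ≤ 1 := fun j => by unfold stepSeq; split_ifs <;> norm_num
  have hP : ∀ i, P i = ∑ j ∈ Finset.range q, stepSeq k j * ‖inner ℂ (z j) (v i)‖ ^ 2 := by
    intro i
    simp only [P]
    rw [hXd, norm_sq_diagMap z hS.right hqm]
    simp only [stepSeq_sq]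
  have hP1 : ∀ i, P i ≤ 1 := by
    intro i
    rw [hP]
    refine le_trans (Finset.sum_le_sum fun j _ =>
      mul_le_of_le_one_left (by positivity) (hst1 j)) ?_
    exact (hS.left.sum_sq_norm_inner_le _ hqn).trans (hT.left.norm_sq_le_one i)
  have hQ1 : ∀ i, Q i ≤ 1 := by
    intro i
    refine le_trans (Finset.sum_le_sum fun j _ =>
      mul_le_of_le_one_left (by positivity) (hst1 j)) ?_
    exact (hS.right.sum_sq_norm_inner_le _ hqm).trans (hT.right.norm_sq_le_one i)
  have hP0 : ∀ i, 0 ≤ P i := fun i => by positivity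
  have hQ0 : ∀ i, 0 ≤ Q i := fun i =>
    Finset.sum_nonneg fun j _ => mul_nonneg (hst0 j) (by positivity)
  have hsumP : ∑ i ∈ Finset.range n, P i = k := by
    rw [← sum_sq_singularValues hm hT.left X, ← sum_stepSeq hkq]
    exact Finset.sum_congr rfl fun i _ => by rw [hX, stepSeq_sq]
  have hsumQ : ∑ i ∈ Finset.range m, Q i = k := by
    simp only [Q]
    rw [Finset.sum_comm, ← sum_stepSeq hkq]
    refine Finset.sum_congr rfl fun j hj => ?_
    rw [← Finset.mul_sum, Finset.sum_congr rfl fun i _ => by rw [norm_inner_symm],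
      hT.right.sum_sq_norm_inner,
      hS.right.norm_eq_one (lt_of_lt_of_le (Finset.mem_range.1 hj) hqm)]
    ring
  have hcg : ∀ i, c i ≤ g i := by
    intro i
    simp only [c, g]
    rw [hP, hXd, diagMap_apply, inner_sum, Complex.re_sum, ← Finset.sum_add_distrib,
      Finset.sum_div]
    refine Finset.sum_le_sum fun j _ => ?_
    rw [inner_smul_right, inner_smul_right, Complex.re_ofReal_mul, ← mul_add, mul_div_assoc]
    refine mul_le_mul_of_nonneg_left ?_ (hst0 j)
    refine (Complex.re_le_norm _).trans ?_
    rw [norm_mul, norm_inner_symm (u i)]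
    nlinarith [sq_nonneg (‖inner ℂ (z j) (v i)‖ - ‖inner ℂ (w j) (u i)‖)]
  have hg1 : ∀ i, g i ≤ 1 := fun i => by simp only [g]; linarith [hP1 i, hQ1 i]
  have hg0 : ∀ i, 0 ≤ g i := fun i => by simp only [g]; linarith [hP0 i, hQ0 i]
  have hsumg : ∑ i ∈ Finset.range q, g i ≤ k := by
    simp only [g]
    rw [← Finset.sum_div, Finset.sum_add_distrib]
    have h1 := Finset.sum_le_sum_of_subset_of_nonneg (Finset.range_mono hqn) fun i _ _ => hP0 i
    have h2 := Finset.sum_le_sum_of_subset_of_nonneg (Finset.range_mono hqm) fun i _ _ => hQ0 i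
    linarith
  have hnorm : ∀ i, ‖(T - X) (v i)‖ ^ 2 =
      (T.singularValues i ^ 2 - 2 * (T.singularValues i * c i)) + P i := by
    intro i
    rw [LinearMap.sub_apply, @norm_sub_sq ℂ, hT.apply_left, inner_smul_left, norm_smul, mul_pow,
      Complex.conj_ofReal, Complex.norm_real, Real.norm_eq_abs, sq_abs]
    have h1 : (T.singularValues i : ℝ) ^ 2 * ‖u i‖ ^ 2 = T.singularValues i ^ 2 := by
      by_cases hi : i < m
      · rw [hT.right.norm_eq_one hi]; ring
      · rw [hT.singularValues_eq_zero ((min_le_left _ _).trans (not_lt.1 hi))]; ring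
    rw [h1]
    have h2 : RCLike.re ((T.singularValues i : ℂ) * inner ℂ (u i) (X (v i))) =
        T.singularValues i * c i := Complex.re_ofReal_mul _ _
    rw [h2]
  -- Expanding the squares, the Frobenius equality becomes equality in the trace inequality ∑ s_i
  -- c_i ≤ ∑_{i<k} s_i.
  have hzero : ∑ i ∈ Finset.range q, T.singularValues i * (stepSeq k i - c i) = 0 := by
    rw [sum_sq_singularValues hm hT.left, Finset.sum_congr rfl fun i _ => hnorm i,
      Finset.sum_add_distrib, hsumP, ← Finset.sum_subset (Finset.range_mono hqn)] at hF
    · have h1 : ∀ i, (T.singularValues i - stepSeq k i) ^ 2 =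
          (T.singularValues i ^ 2 - 2 * (T.singularValues i * c i)) -
          2 * (T.singularValues i * (stepSeq k i - c i)) + stepSeq k i := by
        intro i
        linear_combination stepSeq_sq k i
      rw [Finset.sum_congr rfl fun i _ => h1 i, Finset.sum_add_distrib, sum_stepSeq hkq,
        Finset.sum_sub_distrib (fun i => T.singularValues i ^ 2 - 2 * (T.singularValues i * c i)),
        ← Finset.mul_sum] at hF
      linarith
    · intro i _ hi
      rw [hT.singularValues_eq_zero (not_lt.1 (mt Finset.mem_range.2 hi))]
      ring
  set μ := T.singularValues k with hμ
  have hA : ∀ i, 0 ≤ T.singularValues i * (g i - c i) :=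
    fun i => mul_nonneg (hs0 i) (sub_nonneg.2 (hcg i))
  have hB : ∀ i, 0 ≤ (T.singularValues i - μ) * (stepSeq k i - g i) := by
    intro i
    unfold stepSeq
    split_ifs with hi
    · exact mul_nonneg (sub_nonneg.2 (T.singularValues_antitone hi.le)) (sub_nonneg.2 (hg1 i))
    · refine mul_nonneg_of_nonpos_of_nonpos
        (sub_nonpos.2 (T.singularValues_antitone (not_lt.1 hi))) ?_
      linarith [hg0 i]
  have hC : 0 ≤ μ * ∑ i ∈ Finset.range q, (stepSeq k i - g i) := by
    refine mul_nonneg (hs0 k) ?_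
    rw [Finset.sum_sub_distrib, sum_stepSeq hkq]
    linarith
  -- The vanishing slack is a sum of three nonnegative parts: from c ≤ g, from s_i - μ changing sign
  -- at k where g lies in [0, 1], and from ∑ g ≤ k.
  have hsplit : ∑ i ∈ Finset.range q, T.singularValues i * (g i - c i) +
      ∑ i ∈ Finset.range q, (T.singularValues i - μ) * (stepSeq k i - g i) +
      μ * ∑ i ∈ Finset.range q, (stepSeq k i - g i) = 0 := by
    rw [← hzero, Finset.mul_sum, ← Finset.sum_add_distrib, ← Finset.sum_add_distrib]
    exact Finset.sum_congr rfl fun i _ => by ring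
  have hSA := Finset.sum_nonneg fun i (_ : i ∈ Finset.range q) => hA i
  have hSB := Finset.sum_nonneg fun i (_ : i ∈ Finset.range q) => hB i
  have hA' := (Finset.sum_eq_zero_iff_of_nonneg fun i _ => hA i).1
    (by linarith : ∑ i ∈ Finset.range q, T.singularValues i * (g i - c i) = 0)
  have hB' := (Finset.sum_eq_zero_iff_of_nonneg fun i _ => hB i).1
    (by linarith : ∑ i ∈ Finset.range q, (T.singularValues i - μ) * (stepSeq k i - g i) = 0)
  -- The gap enters here: s_i > μ ≥ 0 for i < k forces g i = 1 and c i = g i.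
  have hlow : ∀ i < k, P i = 1 ∧ c i = 1 := by
    intro i hi
    have hiq := Finset.mem_range.2 (lt_of_lt_of_le hi hkq)
    have hsi : μ < T.singularValues i :=
      lt_of_lt_of_le hgap (T.singularValues_antitone (by omega))
    have h1 := hB' i hiq
    have h2 := hA' i hiq
    rw [stepSeq, if_pos hi] at h1
    have h3 := (mul_eq_zero.1 h1).resolve_left (by linarith)
    have h4 := (mul_eq_zero.1 h2).resolve_left (by linarith [hs0 k])
    have h5 : g i = (P i + Q i) / 2 := rfl
    exact ⟨by linarith [hP1 i, hQ1 i], by linarith⟩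
  split_ifs with hi
  · obtain ⟨h1, h2⟩ := hlow i hi
    have h3 : ‖X (v i) - u i‖ ^ 2 = 0 := by
      have h4 : RCLike.re (inner ℂ (X (v i)) (u i)) = c i := by
        rw [← inner_conj_symm]; exact Complex.conj_re _
      rw [@norm_sub_sq ℂ, h4, h2, hT.right.norm_eq_one (by omega)]
      change P i - 2 * 1 + 1 ^ 2 = 0
      rw [h1]; norm_num
    exact sub_eq_zero.1 (norm_eq_zero.1 (sq_eq_zero_iff.1 h3))
  · by_cases hin : i < n
    · have h1 : ∑ j ∈ Finset.range n, (P j - stepSeq k j) = 0 := by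
        rw [Finset.sum_sub_distrib, hsumP, sum_stepSeq (hkq.trans hqn), sub_self]
      have h2 := (Finset.sum_eq_zero_iff_of_nonneg (fun j _ => by
        unfold stepSeq
        split_ifs with hj
        · rw [(hlow j hj).1]; norm_num
        · linarith [hP0 j])).1 h1 i (Finset.mem_range.2 hin)
      rw [stepSeq, if_neg hi, sub_zero] at h2
      exact norm_eq_zero.1 (sq_eq_zero_iff.1 h2)
    · rw [hT.left.eq_zero (not_lt.1 hin), map_zero]

end DiagMap

end

/-! ### Closest partial isometries of given rank and of any rank -/

noncomputable section

variable {m n : ℕ}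

theorem matMap_sub (A B : Matrix (Fin m) (Fin n) ℂ) : matMap (A - B) = matMap A - matMap B :=
  map_sub _ A B

theorem finrank_euclidean (N : ℕ) : Module.finrank ℂ (EuclideanSpace ℂ (Fin N)) = N := by simp

theorem rank_eq_finrank_range_matMap (A : Matrix (Fin m) (Fin n) ℂ) :
    A.rank = Module.finrank ℂ (LinearMap.range (matMap A)) := by
  rw [matMap, Matrix.toEuclideanLin, Matrix.toLpLin_eq_toLin]
  exact Matrix.rank_eq_finrank_range_toLin A _ _

theorem rank_le_min (A : Matrix (Fin m) (Fin n) ℂ) : A.rank ≤ min m n :=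
  le_min (by simpa using A.rank_le_height) (by simpa using A.rank_le_width)

theorem one_le_rank_of_ne_zero {A : Matrix (Fin m) (Fin n) ℂ} (hA : A ≠ 0) : 1 ≤ A.rank := by
  rw [Nat.one_le_iff_ne_zero]
  intro h
  rw [rank_eq_finrank_range_matMap, Submodule.finrank_eq_zero, LinearMap.range_eq_bot] at h
  exact hA (Matrix.toEuclideanLin.map_eq_zero_iff.1 h)

theorem gaugeNorm_eq (Φ : Seminorm ℝ (Fin (min m n) → ℝ)) (A : Matrix (Fin m) (Fin n) ℂ) :
    gaugeNorm Φ A = Φ fun i => (matMap A).singularValues i := rfl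

/-- Mirsky's inequality for unitarily invariant norms, with the case of equality. -/
theorem IsSymmetricGauge.abs_sub_le_gaugeNorm {Φ : Seminorm ℝ (Fin (min m n) → ℝ)}
    (hΦ : IsSymmetricGauge Φ) (F X : Matrix (Fin m) (Fin n) ℂ) :
    Φ (fun i => |(matMap F).singularValues i - (matMap X).singularValues i|) ≤
      gaugeNorm Φ (F - X) ∧
    (IsStrictlyConvexGauge Φ →
      Φ (fun i => |(matMap F).singularValues i - (matMap X).singularValues i|) =
        gaugeNorm Φ (F - X) →
      ∑ i ∈ Finset.range (min m n), (matMap F - matMap X).singularValues i ^ 2 =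
        ∑ i ∈ Finset.range (min m n),
          ((matMap F).singularValues i - (matMap X).singularValues i : ℝ) ^ 2) := by
  obtain ⟨v, u, h⟩ := exists_isSVD (finrank_euclidean n) (finrank_euclidean m)
    (matMap F - matMap X)
  have key := hΦ.le_of_truncated_sums
    (d := fun i => |(matMap F).singularValues i - (matMap X).singularValues i|)
    (c := fun i => (matMap F - matMap X).singularValues i) (fun i => abs_nonneg _)
    (fun i => LinearMap.singularValues_nonneg _ _) (fun t ht =>
      sum_truncated_abs_sub_singularValues_le h.left h.right
        (LinearMap.singularValues_nonneg _) (fun x => by rw [← h.apply_eq]; rfl) ht)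
  rw [gaugeNorm_eq, matMap_sub]
  refine ⟨key.1, fun hs he => ?_⟩
  have h1 := key.2 hs he
  simp only [sq_abs] at h1
  rw [Fin.sum_univ_eq_sum_range
    (fun i => ((matMap F).singularValues i - (matMap X).singularValues i : ℝ) ^ 2),
    Fin.sum_univ_eq_sum_range (fun i => (matMap F - matMap X).singularValues i ^ 2)] at h1
  exact h1.symm

/-- Mirsky's bound against the zero map, after the signs of the entries are absorbed into the basis
`u`. The entries need not be sorted, and this one inequality is enough to show that the truncation
attains the lower bound. -/
theorem IsSymmetricGauge.gaugeNorm_le_of_diagMap {Φ : Seminorm ℝ (Fin (min m n) → ℝ)}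
    (hΦ : IsSymmetricGauge Φ) {A : Matrix (Fin m) (Fin n) ℂ} {v : ℕ → EuclideanSpace ℂ (Fin n)}
    {u : ℕ → EuclideanSpace ℂ (Fin m)} (hv : IsBasisSeq n v) (hu : IsBasisSeq m u) {c : ℕ → ℝ}
    (hA : matMap A = diagMap (min m n) v u c) : gaugeNorm Φ A ≤ Φ fun i => |c i| := by
  let ε : ℕ → ℝ := fun i => if 0 ≤ c i then 1 else -1
  have hε : ∀ i, |ε i| = 1 := by intro i; simp only [ε]; split_ifs <;> simp
  have hcε : ∀ i, |c i| * ε i = c i := by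
    intro i; simp only [ε]
    split_ifs with h
    · rw [abs_of_nonneg h, mul_one]
    · rw [abs_of_neg (not_le.1 h)]; ring
  refine (hΦ.le_of_truncated_sums (fun i => LinearMap.singularValues_nonneg _ _)
    (fun i => abs_nonneg _) fun t ht => ?_).1
  have key := sum_truncated_abs_sub_singularValues_le (T := matMap A) (S := 0) hv (hu.signed hε)
    (c := fun i => |c i|) (fun i => abs_nonneg _) (fun x => by
      rw [hA, diagMap_apply, LinearMap.zero_apply, sub_zero]
      refine Finset.sum_congr rfl fun i _ => ?_
      rw [smul_comm (inner ℂ (v i) x) (ε i : ℂ), smul_smul ((|c i| : ℝ) : ℂ), ← Complex.ofReal_mul,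
        hcε]) ht
  simpa [abs_of_nonneg (LinearMap.singularValues_nonneg _ _)] using key

/-- The vector of differences between the singular values of `F` and of a partial isometry of
rank `k`. -/
def gapVec (F : Matrix (Fin m) (Fin n) ℂ) (k : ℕ) : Fin (min m n) → ℝ :=
  fun i => |(matMap F).singularValues i - stepSeq k i|

theorem singularValues_of_mem_partialIsometriesOfRank {k : ℕ} {X : Matrix (Fin m) (Fin n) ℂ}
    (hX : X ∈ partialIsometriesOfRank m n k) (i : ℕ) :
    (matMap X).singularValues i = stepSeq k i := by
  rw [singularValues_of_partialIsometry _ hX.1, ← rank_eq_finrank_range_matMap, hX.2]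

theorem IsSymmetricGauge.gapVec_le_gaugeNorm {Φ : Seminorm ℝ (Fin (min m n) → ℝ)}
    (hΦ : IsSymmetricGauge Φ) (F : Matrix (Fin m) (Fin n) ℂ) {k : ℕ}
    {X : Matrix (Fin m) (Fin n) ℂ} (hX : X ∈ partialIsometriesOfRank m n k) :
    Φ (gapVec F k) ≤ gaugeNorm Φ (F - X) := by
  have h := (hΦ.abs_sub_le_gaugeNorm F X).1
  simp only [singularValues_of_mem_partialIsometriesOfRank hX] at h
  exact h

/-- The truncated singular value decomposition of rank `k`, as a matrix. -/
def truncMatrix (k : ℕ) (v : ℕ → EuclideanSpace ℂ (Fin n)) (u : ℕ → EuclideanSpace ℂ (Fin m)) :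
    Matrix (Fin m) (Fin n) ℂ :=
  Matrix.toEuclideanLin.symm (truncMap (min m n) k v u)

theorem matMap_truncMatrix (k : ℕ) (v : ℕ → EuclideanSpace ℂ (Fin n))
    (u : ℕ → EuclideanSpace ℂ (Fin m)) :
    matMap (truncMatrix k v u) = truncMap (min m n) k v u :=
  LinearEquiv.apply_symm_apply _ _

theorem truncMatrix_mem {k : ℕ} (hk : k ≤ min m n) {v : ℕ → EuclideanSpace ℂ (Fin n)}
    {u : ℕ → EuclideanSpace ℂ (Fin m)} (hv : IsBasisSeq n v) (hu : IsBasisSeq m u) :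
    truncMatrix k v u ∈ partialIsometriesOfRank m n k := by
  refine ⟨fun f hf => ?_, ?_⟩
  · rw [matMap_truncMatrix] at hf ⊢
    exact norm_truncMap_of_mem_orthogonal_ker hv hu (min_le_right _ _) (min_le_left _ _) hk f hf
  · rw [rank_eq_finrank_range_matMap, matMap_truncMatrix]
    exact finrank_range_truncMap hv hu (min_le_right _ _) (min_le_left _ _) hk

theorem IsSymmetricGauge.gaugeNorm_sub_truncMatrix_le {Φ : Seminorm ℝ (Fin (min m n) → ℝ)}
    (hΦ : IsSymmetricGauge Φ) {F : Matrix (Fin m) (Fin n) ℂ} (k : ℕ)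
    {v : ℕ → EuclideanSpace ℂ (Fin n)} {u : ℕ → EuclideanSpace ℂ (Fin m)}
    (h : IsSVD (matMap F) n m v u) :
    gaugeNorm Φ (F - truncMatrix k v u) ≤ Φ (gapVec F k) := by
  refine hΦ.gaugeNorm_le_of_diagMap (c := fun i => (matMap F).singularValues i - stepSeq k i)
    h.left h.right ?_
  rw [matMap_sub, matMap_truncMatrix]
  ext1 x
  rw [LinearMap.sub_apply, h.apply_eq, diagMap_apply, diagMap_apply, ← Finset.sum_sub_distrib]
  exact Finset.sum_congr rfl fun i _ => by rw [Complex.ofReal_sub, sub_smul]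

/-- The closest partial isometries of rank `k` are those attaining Mirsky's bound. -/
theorem IsSymmetricGauge.mem_closestIn_rank_iff {Φ : Seminorm ℝ (Fin (min m n) → ℝ)}
    (hΦ : IsSymmetricGauge Φ) {F : Matrix (Fin m) (Fin n) ℂ} {k : ℕ} (hk : k ≤ min m n)
    {X : Matrix (Fin m) (Fin n) ℂ} :
    X ∈ closestIn Φ F (partialIsometriesOfRank m n k) ↔
      X ∈ partialIsometriesOfRank m n k ∧ gaugeNorm Φ (F - X) = Φ (gapVec F k) := by
  obtain ⟨v, u, h⟩ := exists_isSVD (finrank_euclidean n) (finrank_euclidean m) (matMap F)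
  refine ⟨fun ⟨h1, h2⟩ => ⟨h1, le_antisymm ?_ (hΦ.gapVec_le_gaugeNorm F h1)⟩,
    fun ⟨h1, h2⟩ => ⟨h1, fun Y hY => h2.trans_le (hΦ.gapVec_le_gaugeNorm F hY)⟩⟩
  exact (h2 _ (truncMatrix_mem hk h.left h.right)).trans (hΦ.gaugeNorm_sub_truncMatrix_le k h)

theorem IsSymmetricGauge.truncMatrix_mem_closestIn {Φ : Seminorm ℝ (Fin (min m n) → ℝ)}
    (hΦ : IsSymmetricGauge Φ) {F : Matrix (Fin m) (Fin n) ℂ} {k : ℕ} (hk : k ≤ min m n)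
    {v : ℕ → EuclideanSpace ℂ (Fin n)} {u : ℕ → EuclideanSpace ℂ (Fin m)}
    (h : IsSVD (matMap F) n m v u) :
    truncMatrix k v u ∈ closestIn Φ F (partialIsometriesOfRank m n k) := by
  have h1 := truncMatrix_mem hk h.left h.right
  exact (hΦ.mem_closestIn_rank_iff hk).2
    ⟨h1, le_antisymm (hΦ.gaugeNorm_sub_truncMatrix_le k h) (hΦ.gapVec_le_gaugeNorm F h1)⟩

/-- Under strict convexity and a gap after the `k`-th singular value, the closest partial isometry
of rank `k` is the truncated singular value decomposition. -/
theorem IsSymmetricGauge.eq_truncMatrix_of_mem_closestIn {Φ : Seminorm ℝ (Fin (min m n) → ℝ)}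
    (hΦ : IsSymmetricGauge Φ) (hs : IsStrictlyConvexGauge Φ) {F X : Matrix (Fin m) (Fin n) ℂ}
    {k : ℕ} (hk1 : 1 ≤ k) (hk : k ≤ min m n) {v : ℕ → EuclideanSpace ℂ (Fin n)}
    {u : ℕ → EuclideanSpace ℂ (Fin m)} (h : IsSVD (matMap F) n m v u)
    (hgap : (matMap F).singularValues k < (matMap F).singularValues (k - 1))
    (hX : X ∈ closestIn Φ F (partialIsometriesOfRank m n k)) : X = truncMatrix k v u := by
  obtain ⟨hX1, hX2⟩ := (hΦ.mem_closestIn_rank_iff hk).1 hX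
  have hXs := singularValues_of_mem_partialIsometriesOfRank hX1
  have h1 := (hΦ.abs_sub_le_gaugeNorm F X).2 hs
  simp only [hXs] at h1
  have h2 := apply_eq_of_sum_sq_singularValues_sub h hXs hk1 hgap (h1 hX2.symm)
  refine Matrix.toEuclideanLin.injective (h.left.linearMap_ext fun i => ?_)
  change matMap X (v i) = matMap (truncMatrix k v u) (v i)
  rw [h2, matMap_truncMatrix, truncMap_apply_basis h.left (min_le_right _ _) hk]

theorem exists_rank_of_mem_partialIsometries {X : Matrix (Fin m) (Fin n) ℂ}
    (hX : X ∈ partialIsometries m n) :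
    ∃ j, 1 ≤ j ∧ j ≤ min m n ∧ X ∈ partialIsometriesOfRank m n j :=
  ⟨X.rank, one_le_rank_of_ne_zero hX.2, rank_le_min X, hX.1, rfl⟩

theorem partialIsometriesOfRank_subset {k : ℕ} (hk : 1 ≤ k) :
    partialIsometriesOfRank m n k ⊆ partialIsometries m n := by
  rintro X ⟨h1, h2⟩
  refine ⟨h1, ?_⟩
  rintro rfl
  rw [Matrix.rank_zero] at h2
  omega

theorem gapVec_nonneg (F : Matrix (Fin m) (Fin n) ℂ) (k : ℕ) (i : Fin (min m n)) :
    0 ≤ gapVec F k i := abs_nonneg _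

/-- Coordinatewise, rounding s_i to the nearer of 0 and 1 is optimal. The index 0 is exempt from
`hlo`: a competitor of rank j ≥ 1 also has a 1 there. -/
theorem gapVec_le_gapVec {F : Matrix (Fin m) (Fin n) ℂ} {k j : ℕ} (hj : 1 ≤ j)
    (hlo : ∀ i, 1 ≤ i → i < k → 1 / 2 ≤ (matMap F).singularValues i)
    (hhi : ∀ i, k ≤ i → (matMap F).singularValues i ≤ 1 / 2) (i : Fin (min m n)) :
    gapVec F k i ≤ gapVec F j i := by
  have h0 := (matMap F).singularValues_nonneg i
  unfold gapVec stepSeq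
  split_ifs with h1 h2 h2
  · exact le_rfl
  · have := hlo i (by omega) h1
    rw [sub_zero, abs_of_nonneg h0, abs_le]
    constructor <;> linarith
  · have := hhi i (by omega)
    rw [sub_zero, abs_of_nonneg h0, abs_of_nonpos (by linarith)]
    linarith
  · exact le_rfl

/-- Where one rank rounds up and the other down, equal entries mean |s - 1| = s, whose only solution
is 1/2. -/
theorem eq_half_of_gapVec_eq {F : Matrix (Fin m) (Fin n) ℂ} {k j i : ℕ}
    (h : gapVec F k = gapVec F j) (hk : k ≤ i) (hj : i < j) (hi : i < min m n) :
    (matMap F).singularValues i = 1 / 2 := by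
  have h0 := (matMap F).singularValues_nonneg i
  have h1 := congrFun h ⟨i, hi⟩
  simp only [gapVec, stepSeq, if_neg (not_lt.2 hk), if_pos hj, sub_zero, abs_of_nonneg h0] at h1
  rcases abs_cases ((matMap F).singularValues i - 1 : ℝ) with ⟨h2, -⟩ | ⟨h2, -⟩ <;> linarith

/-- If the singular values of index `< b` are at least `1/2` (the first one excepted) and those
after the first `a` are at most `1/2`, the closest partial isometries of rank `a, …, b` are global
minimizers; in the strictly convex case there are no others if the range `a, …, b` is maximal. -/
theorem IsSymmetricGauge.closestIn_rank_Icc {Φ : Seminorm ℝ (Fin (min m n) → ℝ)}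
    (hΦ : IsSymmetricGauge Φ) {F : Matrix (Fin m) (Fin n) ℂ} {a b : ℕ} (ha : 1 ≤ a) (hab : a ≤ b)
    (hb : b ≤ min m n) (hlo : ∀ i, 1 ≤ i → i < b → 1 / 2 ≤ (matMap F).singularValues i)
    (hhi : ∀ i, a ≤ i → (matMap F).singularValues i ≤ 1 / 2) :
    (∀ j ∈ Set.Icc a b, (closestIn Φ F (partialIsometriesOfRank m n j)).Nonempty ∧
      closestIn Φ F (partialIsometriesOfRank m n j) ⊆ closestIn Φ F (partialIsometries m n)) ∧
    (IsStrictlyConvexGauge Φ → (2 ≤ a → (matMap F).singularValues (a - 1) ≠ 1 / 2) →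
      (b < min m n → (matMap F).singularValues b ≠ 1 / 2) →
      closestIn Φ F (partialIsometries m n) =
        ⋃ j ∈ Set.Icc a b, closestIn Φ F (partialIsometriesOfRank m n j)) := by
  obtain ⟨v, u, h⟩ := exists_isSVD (finrank_euclidean n) (finrank_euclidean m) (matMap F)
  have hopt : ∀ j ∈ Set.Icc a b, ∀ j', 1 ≤ j' → ∀ i, gapVec F j i ≤ gapVec F j' i :=
    fun j hj j' hj' => gapVec_le_gapVec hj' (fun i h1 h2 => hlo i h1 (h2.trans_le hj.2))
      (fun i h1 => hhi i (hj.1.trans h1))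
  have hmain : ∀ j ∈ Set.Icc a b, (closestIn Φ F (partialIsometriesOfRank m n j)).Nonempty ∧
      closestIn Φ F (partialIsometriesOfRank m n j) ⊆ closestIn Φ F (partialIsometries m n) := by
    intro j hj
    have hjq : j ≤ min m n := hj.2.trans hb
    refine ⟨⟨_, hΦ.truncMatrix_mem_closestIn hjq h⟩, fun X hX => ?_⟩
    obtain ⟨h1, h2⟩ := (hΦ.mem_closestIn_rank_iff hjq).1 hX
    refine ⟨partialIsometriesOfRank_subset (ha.trans hj.1) h1, fun Y hY => ?_⟩
    obtain ⟨j', hj1, -, hY'⟩ := exists_rank_of_mem_partialIsometries hY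
    rw [h2]
    exact (hΦ.mono (gapVec_nonneg F j) (hopt j hj j' hj1)).1.trans (hΦ.gapVec_le_gaugeNorm F hY')
  refine ⟨hmain, fun hs hae hbe => Set.Subset.antisymm (fun X hX => ?_) ?_⟩
  · obtain ⟨j', hj1, hjq, hX'⟩ := exists_rank_of_mem_partialIsometries hX.1
    have hlow := hΦ.gapVec_le_gaugeNorm F hX'
    have hup : ∀ j ∈ Set.Icc a b, gaugeNorm Φ (F - X) ≤ Φ (gapVec F j) := by
      intro j hj
      have h1 := truncMatrix_mem (hj.2.trans hb) h.left h.right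
      exact (hX.2 _ (partialIsometriesOfRank_subset (ha.trans hj.1) h1)).trans
        (hΦ.gaugeNorm_sub_truncMatrix_le j h)
    have hge : ∀ j ∈ Set.Icc a b, gapVec F j = gapVec F j' ∧ Φ (gapVec F j) = Φ (gapVec F j') := by
      intro j hj
      obtain ⟨h1, h2⟩ := hΦ.mono (gapVec_nonneg F j) (hopt j hj j' hj1)
      have h3 := h1.antisymm (hlow.trans (hup j hj))
      exact ⟨h2 hs h3, h3⟩
    have haa : a ∈ Set.Icc a b := ⟨le_rfl, hab⟩
    have hbb : b ∈ Set.Icc a b := ⟨hab, le_rfl⟩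
    refine Set.mem_iUnion₂.2 ⟨j', ⟨?_, ?_⟩, (hΦ.mem_closestIn_rank_iff hjq).2 ⟨hX', ?_⟩⟩
    -- A minimizer has the same gap vector as the ranks a and b. A rank below a would give 1/2 at
    -- index a - 1, and a rank above b would give it at index b; maximality of the range excludes
    -- both.
    · by_contra! hlt
      exact hae (by omega) (eq_half_of_gapVec_eq (hge a haa).1.symm (by omega) (by omega)
        (by omega))
    · by_contra! hlt
      exact hbe (by omega) (eq_half_of_gapVec_eq (hge b hbb).1 le_rfl hlt (by omega))
    · exact le_antisymm ((hup a haa).trans_eq (hge a haa).2) hlow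
  · exact Set.iUnion₂_subset fun j hj => (hmain j hj).2

end

/-! ### The canonical polar decomposition -/

noncomputable section

variable {m n : ℕ}

theorem matMap_mul_apply {l : ℕ} (A : Matrix (Fin m) (Fin n) ℂ) (B : Matrix (Fin n) (Fin l) ℂ)
    (x : EuclideanSpace ℂ (Fin l)) : matMap (A * B) x = matMap A (matMap B x) := by
  ext i
  simp [matMap, Matrix.toLpLin_apply]

theorem IsSVD.matMap_conjTranspose_mul_self_apply {F : Matrix (Fin m) (Fin n) ℂ}
    {v : ℕ → EuclideanSpace ℂ (Fin n)} {u : ℕ → EuclideanSpace ℂ (Fin m)}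
    (h : IsSVD (matMap F) n m v u) (i : ℕ) :
    matMap (F.conjTranspose * F) (v i) =
      (((matMap F).singularValues i ^ 2 : ℝ) : ℂ) • v i := by
  rw [matMap_mul_apply, matMap, Matrix.toEuclideanLin_conjTranspose_eq_adjoint]
  refine ext_inner_left ℂ fun x => ?_
  rw [LinearMap.adjoint_inner_right, ← h.left.sum_inner_smul x, map_sum, sum_inner, sum_inner]
  refine Finset.sum_congr rfl fun j _ => ?_
  change inner ℂ (matMap F _) (matMap F _) = _
  rw [map_smul, h.apply_left, h.apply_left]
  simp only [inner_smul_left, inner_smul_right, h.left.inner_eq, h.right.inner_eq,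
    Complex.conj_ofReal]
  by_cases hij : j = i
  · subst hij
    by_cases hj : j < min m n
    · have := lt_min_iff.1 hj
      simp [this.1, this.2]
      ring
    · rw [h.singularValues_eq_zero (not_lt.1 hj)]
      simp
  · simp [hij]

open scoped MatrixOrder in
/-- `|F|` is diagonal in the right singular vectors. -/
theorem IsSVD.matMap_matAbs_apply {F : Matrix (Fin m) (Fin n) ℂ}
    {v : ℕ → EuclideanSpace ℂ (Fin n)} {u : ℕ → EuclideanSpace ℂ (Fin m)}
    (h : IsSVD (matMap F) n m v u) (i : ℕ) :
    matMap (matAbs F) (v i) = ((matMap F).singularValues i : ℂ) • v i := by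
  -- A is positive with square F*F, hence equals |F| by uniqueness of the positive square root.
  let A : Matrix (Fin n) (Fin n) ℂ :=
    Matrix.toEuclideanLin.symm (diagMap n v v (matMap F).singularValues)
  have hA : matMap A = diagMap n v v (matMap F).singularValues := LinearEquiv.apply_symm_apply _ _
  have hAv : ∀ i, matMap A (v i) = ((matMap F).singularValues i : ℂ) • v i := by
    intro i
    rw [hA, diagMap_apply_basis h.left le_rfl]
    split_ifs with hi
    · rfl
    · rw [h.left.eq_zero (not_lt.1 hi), smul_zero]
  have hpos : 0 ≤ A := by
    rw [Matrix.nonneg_iff_posSemidef, ← Matrix.isPositive_toEuclideanLin_iff]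
    change (matMap A).IsPositive
    rw [hA]
    refine LinearMap.isPositive_sum _ fun i _ => ?_
    refine LinearMap.IsPositive.smul_of_nonneg ?_
      (Complex.zero_le_real.2 ((matMap F).singularValues_nonneg i))
    exact (InnerProductSpace.isPositive_rankOne_self (v i)).toLinearMap
  have hsq : A * A = F.conjTranspose * F := by
    refine Matrix.toEuclideanLin.injective (h.left.linearMap_ext fun i => ?_)
    change matMap (A * A) (v i) = matMap (F.conjTranspose * F) (v i)
    rw [h.matMap_conjTranspose_mul_self_apply, matMap_mul_apply, hAv, map_smul, hAv, smul_smul,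
      pow_two, Complex.ofReal_mul]
  have hAF : matAbs F = A := CFC.sqrt_unique hsq hpos
  rw [hAF, hAv]

/-- The canonical polar factor is the truncated singular value decomposition at the rank. -/
theorem IsSVD.isCanonicalPolar_iff {F U : Matrix (Fin m) (Fin n) ℂ}
    {v : ℕ → EuclideanSpace ℂ (Fin n)} {u : ℕ → EuclideanSpace ℂ (Fin m)}
    (h : IsSVD (matMap F) n m v u) : IsCanonicalPolar F U ↔ U = truncMatrix F.rank v u := by
  have hrank := rank_le_min F
  have hs : ∀ i, 0 < (matMap F).singularValues i ↔ i < F.rank := by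
    intro i
    rw [LinearMap.singularValues_pos_iff_lt_finrank_range, rank_eq_finrank_range_matMap]
  have hs0 : ∀ i, ¬ i < F.rank → (matMap F).singularValues i = 0 := fun i hi =>
    le_antisymm (not_lt.1 (mt (hs i).1 hi)) ((matMap F).singularValues_nonneg i)
  have htr := fun i => truncMap_apply_basis (k := F.rank) h.left (min_le_right m n) hrank u i
  constructor
  · rintro ⟨-, hker, hF⟩
    refine Matrix.toEuclideanLin.injective (h.left.linearMap_ext fun i => ?_)
    change matMap U (v i) = matMap (truncMatrix F.rank v u) (v i)
    rw [matMap_truncMatrix, htr]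
    -- For i below the rank, s_i u_i = F v_i = s_i U v_i with s_i ≠ 0; the other v_i lie in ker F =
    -- ker U.
    split_ifs with hi
    · have h1 : matMap F (v i) = matMap U (matMap (matAbs F) (v i)) := by
        rw [← matMap_mul_apply, ← hF]
      rw [h.matMap_matAbs_apply, map_smul, h.apply_left] at h1
      have h2 : ((matMap F).singularValues i : ℂ) ≠ 0 := by exact_mod_cast ((hs i).2 hi).ne'
      exact (smul_right_injective _ h2 h1).symm
    · rw [← LinearMap.mem_ker, hker, LinearMap.mem_ker, h.apply_left, hs0 i hi]
      simp
  · rintro rfl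
    refine ⟨(truncMatrix_mem hrank h.left h.right).1, ?_, ?_⟩
    · ext x
      rw [LinearMap.mem_ker, LinearMap.mem_ker, matMap_truncMatrix, h.eq_diagMap,
        diagMap_eq_zero_iff v h.right (min_le_left _ _),
        diagMap_eq_zero_iff v h.right (min_le_left _ _)]
      refine forall₂_congr fun i _ => imp_congr_left ?_
      rw [← LinearMap.singularValues_pos_iff_ne_zero, hs]
      unfold stepSeq
      split_ifs <;> simp [*]
    · refine Matrix.toEuclideanLin.injective (h.left.linearMap_ext fun i => ?_)
      change matMap F (v i) = matMap (truncMatrix F.rank v u * matAbs F) (v i)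
      rw [matMap_mul_apply, h.matMap_matAbs_apply, map_smul, matMap_truncMatrix, htr, h.apply_left]
      split_ifs with hi
      · rfl
      · rw [hs0 i hi]; simp

end

/-! ### The cases of the theorem -/

theorem mainTheorem4 (m n : ℕ) (hm : 0 < m) (hn : 0 < n)
    (Φ : Seminorm ℝ (Fin (min m n) → ℝ)) (hΦ : IsSymmetricGauge Φ)
    (F : Matrix (Fin m) (Fin n) ℂ) (r : ℕ) (hr : F.rank = r) :
    -- a) no nonzero singular value equals 1/2
    ((∀ i, 1 ≤ i → i ≤ r → singVal F i ≠ 1 / 2) →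
      -- a i) all nonzero singular values exceed 1/2
      (1 ≤ r → 1 / 2 < singVal F r →
        (∃! U, IsCanonicalPolar F U) ∧
        ∀ U, IsCanonicalPolar F U →
          U ∈ closestIn Φ F (partialIsometries m n) ∧
          (IsStrictlyConvexGauge Φ → closestIn Φ F (partialIsometries m n) = {U})) ∧
      -- a i) exactly the first k of the nonzero singular values exceed 1/2, 1 ≤ k < r
      (∀ k, 1 ≤ k → k + 1 ≤ r → 1 / 2 < singVal F k → singVal F (k + 1) < 1 / 2 →
        (closestIn Φ F (partialIsometriesOfRank m n k)).Nonempty ∧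
        closestIn Φ F (partialIsometriesOfRank m n k) ⊆ closestIn Φ F (partialIsometries m n) ∧
        (IsStrictlyConvexGauge Φ →
          (∃! X, X ∈ closestIn Φ F (partialIsometriesOfRank m n k)) ∧
          closestIn Φ F (partialIsometries m n) =
            closestIn Φ F (partialIsometriesOfRank m n k))) ∧
      -- a ii) all singular values are below 1/2
      (singVal F 1 < 1 / 2 →
        (closestIn Φ F (partialIsometriesOfRank m n 1)).Nonempty ∧
        closestIn Φ F (partialIsometriesOfRank m n 1) ⊆ closestIn Φ F (partialIsometries m n) ∧
        (IsStrictlyConvexGauge Φ →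
          closestIn Φ F (partialIsometries m n) =
            closestIn Φ F (partialIsometriesOfRank m n 1)))) ∧
    -- b) the singular values equal to 1/2 are those with index k, …, k + l
    (∀ k l, 1 ≤ k → k + l ≤ r →
      {j : ℕ | 1 ≤ j ∧ j ≤ min m n ∧ singVal F j = 1 / 2} = Set.Icc k (k + l) →
      -- b i)
      (k = 1 →
        (∀ j ∈ Set.Icc 1 (l + 1),
          (closestIn Φ F (partialIsometriesOfRank m n j)).Nonempty ∧
          closestIn Φ F (partialIsometriesOfRank m n j) ⊆
            closestIn Φ F (partialIsometries m n)) ∧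
        (IsStrictlyConvexGauge Φ →
          closestIn Φ F (partialIsometries m n) =
            ⋃ j ∈ Set.Icc 1 (l + 1), closestIn Φ F (partialIsometriesOfRank m n j))) ∧
      -- b ii)
      (1 < k →
        (∀ j ∈ Set.Icc (k - 1) (k + l),
          (closestIn Φ F (partialIsometriesOfRank m n j)).Nonempty ∧
          closestIn Φ F (partialIsometriesOfRank m n j) ⊆
            closestIn Φ F (partialIsometries m n)) ∧
        (IsStrictlyConvexGauge Φ →
          closestIn Φ F (partialIsometries m n) =
            ⋃ j ∈ Set.Icc (k - 1) (k + l), closestIn Φ F (partialIsometriesOfRank m n j)))) := by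
  have hrq : r ≤ min m n := hr ▸ rank_le_min F
  have hpos : ∀ i, 0 < (matMap F).singularValues i ↔ i < r := by
    intro i
    rw [LinearMap.singularValues_pos_iff_lt_finrank_range, ← hr, rank_eq_finrank_range_matMap]
  have hanti := (matMap F).singularValues_antitone
  obtain ⟨v, u, h⟩ := exists_isSVD (finrank_euclidean n) (finrank_euclidean m) (matMap F)
  -- With `singularValues` indexed from 0, s_k is the value at k - 1 and s_{k+1} the value at k. No
  -- condition is put on index 0, so k = 1 also covers case a ii).
  have hsingle : ∀ k, 1 ≤ k → k ≤ min m n →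
      (∀ i, 1 ≤ i → i < k → 1 / 2 < (matMap F).singularValues i) →
      (∀ i, k ≤ i → (matMap F).singularValues i < 1 / 2) →
      (2 ≤ k → (matMap F).singularValues (k - 1) ≠ 1 / 2) →
      ((closestIn Φ F (partialIsometriesOfRank m n k)).Nonempty ∧
        closestIn Φ F (partialIsometriesOfRank m n k) ⊆ closestIn Φ F (partialIsometries m n)) ∧
      (IsStrictlyConvexGauge Φ →
        closestIn Φ F (partialIsometries m n) =
          closestIn Φ F (partialIsometriesOfRank m n k)) := by
    intro k hk hkq hlo hhi hke
    obtain ⟨h1, h2⟩ := hΦ.closestIn_rank_Icc (F := F) hk le_rfl hkq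
      (fun i hi hik => (hlo i hi hik).le) (fun i hi => (hhi i hi).le)
    refine ⟨h1 k ⟨le_rfl, le_rfl⟩, fun hs => ?_⟩
    rw [h2 hs hke (fun _ => (hhi k le_rfl).ne)]
    simp
  have hgapcase : ∀ k, 1 ≤ k → k ≤ min m n → 1 / 2 < (matMap F).singularValues (k - 1) →
      (matMap F).singularValues k < 1 / 2 →
      truncMatrix k v u ∈ closestIn Φ F (partialIsometriesOfRank m n k) ∧
      closestIn Φ F (partialIsometriesOfRank m n k) ⊆ closestIn Φ F (partialIsometries m n) ∧
      (IsStrictlyConvexGauge Φ →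
        closestIn Φ F (partialIsometriesOfRank m n k) = {truncMatrix k v u} ∧
        closestIn Φ F (partialIsometries m n) =
          closestIn Φ F (partialIsometriesOfRank m n k)) := by
    intro k hk hkq hlo hhi
    obtain ⟨⟨-, h2⟩, h3⟩ := hsingle k hk hkq
      (fun i _ hik => hlo.trans_le (hanti (by omega))) (fun i hi => (hanti hi).trans_lt hhi)
      (fun _ => hlo.ne')
    have hmem := hΦ.truncMatrix_mem_closestIn hkq h
    refine ⟨hmem, h2, fun hs => ⟨?_, h3 hs⟩⟩
    refine Set.eq_singleton_iff_unique_mem.2 ⟨hmem, fun X hX => ?_⟩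
    exact hΦ.eq_truncMatrix_of_mem_closestIn hs hk hkq h (hhi.trans hlo) hX
  refine ⟨fun _ => ⟨fun hr1 hsr => ?_, fun k hk hkr hsk hsk1 => ?_, fun hs1 => ?_⟩,
    fun k l hk hkl hset => ?_⟩
  -- The polar factor is the case k = r of the gap case: the next singular value is 0.
  · have hzero : (matMap F).singularValues r < 1 / 2 :=
      (not_lt.1 (mt (hpos r).1 (lt_irrefl r))).trans_lt (by norm_num)
    obtain ⟨h1, h2, h3⟩ := hgapcase r hr1 hrq hsr hzero
    have hpol : ∀ U, IsCanonicalPolar F U ↔ U = truncMatrix r v u := fun U => by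
      rw [h.isCanonicalPolar_iff, hr]
    refine ⟨⟨truncMatrix r v u, (hpol _).2 rfl, fun U hU => (hpol U).1 hU⟩, fun U hU => ?_⟩
    rw [(hpol U).1 hU]
    exact ⟨h2 h1, fun hs => (h3 hs).2.trans (h3 hs).1⟩
  · obtain ⟨h1, h2, h3⟩ := hgapcase k hk (by omega) hsk hsk1
    refine ⟨⟨_, h1⟩, h2, fun hs => ⟨⟨_, h1, fun X hX => ?_⟩, (h3 hs).2⟩⟩
    rw [(h3 hs).1] at hX
    exact hX
  · obtain ⟨⟨h1, h2⟩, h3⟩ := hsingle 1 le_rfl (by omega) (fun i _ _ => by omega)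
      (fun i _ => (hanti (Nat.zero_le i)).trans_lt hs1) (fun _ => by omega)
    exact ⟨h1, h2, h3⟩
  · have hmem : ∀ j, j < min m n →
        ((matMap F).singularValues j = 1 / 2 ↔ k ≤ j + 1 ∧ j + 1 ≤ k + l) := by
      intro j hj
      have h1 := Set.ext_iff.1 hset (j + 1)
      simp only [Set.mem_ofPred_eq, Set.mem_Icc] at h1
      rw [← h1]
      exact ⟨fun h2 => ⟨by omega, by omega, h2⟩, fun h2 => h2.2.2⟩
    have hfirst : (matMap F).singularValues (k - 1) = 1 / 2 :=
      (hmem (k - 1) (by omega)).2 (by omega)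
    have hlast : (matMap F).singularValues (k + l - 1) = 1 / 2 :=
      (hmem (k + l - 1) (by omega)).2 (by omega)
    have hend : k + l < min m n → (matMap F).singularValues (k + l) ≠ 1 / 2 :=
      fun hlt he => by have := (hmem (k + l) hlt).1 he; omega
    have hlo : ∀ i, i < k + l → 1 / 2 ≤ (matMap F).singularValues i :=
      fun i hi => hlast ▸ hanti (by omega)
    have hhi : ∀ i, k - 1 ≤ i → (matMap F).singularValues i ≤ 1 / 2 :=
      fun i hi => hfirst ▸ hanti hi
    refine ⟨?_, fun hk1 => ?_⟩
    · rintro rfl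
      obtain ⟨h1, h2⟩ := hΦ.closestIn_rank_Icc (F := F) (a := 1) (b := l + 1) le_rfl (by omega)
        (by omega) (fun i _ hi => hlo i (by omega)) (fun i _ => hhi i (by omega))
      exact ⟨h1, fun hs => h2 hs (fun _ => by omega) (by rw [add_comm]; exact hend)⟩
    -- Each value 1/2 costs the same kept or dropped, so the ranks run from k - 1 (all dropped) to k
    -- + l (all kept). For k = 1 the lower end would be rank 0, hence the start at 1 in the
    -- preceding case.
    · obtain ⟨h1, h2⟩ := hΦ.closestIn_rank_Icc (F := F) (a := k - 1) (b := k + l) (by omega)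
        (by omega) (by omega) (fun i _ hi => hlo i hi) hhi
      refine ⟨h1, fun hs => h2 hs (fun _ he => ?_) hend⟩
      have := (hmem (k - 1 - 1) (by omega)).1 he
      omega
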